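/- **Setting.** Let $y_1,y_2,\dots$ be data on a probability space, let $\Theta\subseteq\mathbb R^d$ and $\mathcal Z\subseteq\mathbb R^p$ be measurable (for instance $\mathcal Z=\mathbb R^p$), and for each $n$ let $L(y_{1:n},\zeta;\lambda)>0$ be a likelihood on $\Theta\times\mathcal Z$, measurable in $(\lambda,\zeta)$. Almost surely, for all $n\ge 1$ and $\lambda\in\Theta$, let $g_n(\cdot,y_{1:n};\lambda)$ have a unique minimizer $\hat z_n(\lambda)$ over $\mathcal Z$, measurable in $\lambda$. Put $l_n(\lambda,\zeta)=\frac1n\log L(y_{1:n},\zeta;\lambda)$ and $\hat l_n(\lambda)=l_n\{\lambda,\hat z_n(\lambda)\}$. Let $\pi_0$ be a prior probability density on $\Theta$. The *bridged posterior* of $\lambda$ has density proportional to $\pi_0(\lambda)L\{y_{1:n},\hat z_n(\lambda);\lambda\}$ on $\Theta$. Let $\rho(\lambda,\zeta)\ge 0$ be a measurable prior density on $\Theta\times\mathcal Z$ whose integral over $\Theta\times(\mathcal Z\cap B)$ is finite for every bounded $B$ (a probability density, or $\rho=\pi_0(\lambda)$). The *integrated (full) posterior* of $(\lambda,\zeta)$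 has density proportional to $\rho(\lambda,\zeta)L(y_{1:n},\zeta;\lambda)$ on $\Theta\times\mathcal Z$. Let $E\subseteq\Theta$ be open in $\mathbb R^d$ and bounded, let $\lambda_0\in E$, let $\hat z_*$ and $l_*$ be nonrandom functions, and put $\zeta_0=\hat z_*(\lambda_0)$. Let $\pi_0$ be continuous and positive at $\lambda_0$, and $\rho$ continuous and positive at $(\lambda_0,\zeta_0)$. **Assumptions.** * (A1) Almost surely, there are open sets $U_n\subseteq\mathcal Z$ with $\hat z_n(E)\subseteq U_n$ such that, for each $\lambda\in E$, some ball around $\hat z_n(\lambda)$ of radius $r(\lambda)>0$ not depending on $n$ lies in $U_n$ for all $n\geq 1$; $l_n$ is $C^3$ on $E\times U_n$ and $\hat z_n$ is $C^3$ on $E$; $l_n'''$ is bounded on $E\times U_n$, and $\hat z_n'''$ on $E$, uniformly in $n\ge 1$. * (A2) Almost surely, $\hat z_n\to\hat z_*$ pointwise on $\Theta$ and $l_n\to l_*$ pointwise on $\Theta\times\mathcal Z$. * (A3) $-l_*''(\lambda_0,\zeta_0)$ is positive definite and $\partial l_*(\lambda_0,\zeta)/\partial\zeta|_{\zeta=\zeta_0}=0$.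 * (A4) For some compact $K\subseteq E$ with $\lambda_0$ in its interior, $l_*(\lambda,\zeta)<l_*(\lambda_0,\zeta_0)$ for all $\lambda\in K\setminus\{\lambda_0\}$, $\zeta\in\hat z_*(E)$, and almost surely $\limsup_n\sup_{\lambda\in\Theta\setminus K,\ \zeta\in\hat z_n(\Theta)}l_n(\lambda,\zeta)<l_*(\lambda_0,\zeta_0)$. * (Profile likelihood) $g_n(\zeta,y_{1:n};\lambda)=-L(y_{1:n},\zeta;\lambda)$. **Asymptotic variance.** The $j$-th element of a sequence of random vectors in $\mathbb R^p$ has asymptotic variance $v_j$ if the laws of the vectors converge weakly to a probability law on $\mathbb R^p$ whose $j$-th coordinate has finite variance $v_j$. **Claim.** There are nonrandom $v,w\in\mathbb R^p$ with $v_j<w_j$ for every $j=1,\dots,p$ such that, almost surely, there is a sequence $\lambda_n\to\lambda_0$ with $\hat l_n'(\lambda_n)=0$ for all large $n$, and for every such sequence: 1. under the bridged posterior, for every $j$, the $j$-th element of $\sqrt n\{\hat z_n(\lambda)-\hat z_n(\lambda_n)\}$ has asymptotic variance $v_j$; 2. under the full posterior, whenever the elements of $\sqrt n\{\zeta-\hat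 z_n(\lambda_n)\}$ have asymptotic variances, these are $w_1,\dots,w_p$; 3. these asymptotic variances under the full posterior do exist if $\rho$ is integrable over $\Theta\times\mathcal Z$ and, for every $\varepsilon>0$, $\limsup_n\sup\{l_n(\lambda,\zeta):\lambda\in\Theta,\ \zeta\in\mathcal Z,\ \|\zeta-\zeta_0\|\ge\varepsilon\}<l_*(\lambda_0,\zeta_0)$. Hence the asymptotic variance of each element of $\sqrt n\{\hat z_n(\lambda)-\hat z_n(\lambda_n)\}$ under the bridged posterior is strictly smaller than that of the same element of $\sqrt n\{\zeta-\hat z_n(\lambda_n)\}$ under the full posterior. -/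

import Mathlib

open MeasureTheory ProbabilityTheory Filter Topology
open scoped BoundedContinuousFunction

noncomputable section

namespace Bridged

/-- `ℝᵏ` with its Euclidean norm and Lebesgue measure. -/
abbrev Vec (k : ℕ) : Type := EuclideanSpace ℝ (Fin k)

/-- `f` has exactly one minimizer over `Z`. -/
def HasUniqueMin {k : ℕ} (f : Vec k → ℝ) (Z : Set (Vec k)) : Prop :=
  ∃! z, z ∈ Z ∧ ∀ ζ ∈ Z, f z ≤ f ζ

open Classical in
/-- The minimizer of `f` over `Z` (a point chosen among the minimizers; only used when the
minimizer exists and is unique). -/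
def argminOn {k : ℕ} (f : Vec k → ℝ) (Z : Set (Vec k)) : Vec k :=
  Classical.epsilon fun z => z ∈ Z ∧ ∀ ζ ∈ Z, f z ≤ f ζ

theorem argminOn_spec {k : ℕ} {f : Vec k → ℝ} {Z : Set (Vec k)} (h : HasUniqueMin f Z) :
    argminOn f Z ∈ Z ∧ ∀ ζ ∈ Z, f (argminOn f Z) ≤ f ζ :=
  Classical.epsilon_spec (p := fun z => z ∈ Z ∧ ∀ ζ ∈ Z, f z ≤ f ζ) h.exists

/-- The ingredients of a bridged posterior: the parameter space `Θ ⊆ ℝᵈ`, the space `Z ⊆ ℝᵖ` of the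
latent variable, the (full) likelihood `L(y₁,…,yₙ, ζ; lam)`, the loss `gₙ(ζ, y₁,…,yₙ; lam)` whose
minimizer defines the conditionally deterministic latent variable, and the prior density of `lam`. -/
structure Model (𝒴 : Type*) (d p : ℕ) where
  Θ : Set (Vec d)
  Z : Set (Vec p)
  measurableSet_Θ : MeasurableSet Θ
  measurableSet_Z : MeasurableSet Z
  /-- `L n y lam ζ` -/
  L : (n : ℕ) → (Fin n → 𝒴) → Vec d → Vec p → ℝ
  L_pos : ∀ n y, ∀ lam ∈ Θ, ∀ ζ ∈ Z, 0 < L n y lam ζ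
  L_measurable : ∀ n y, Measurable fun x : Vec d × Vec p => L n y x.1 x.2
  /-- `g n y lam ζ` -/
  g : (n : ℕ) → (Fin n → 𝒴) → Vec d → Vec p → ℝ
  prior : Vec d → ℝ
  prior_nonneg : ∀ lam, 0 ≤ prior lam
  prior_measurable : Measurable prior
  prior_integral : ∫⁻ lam in Θ, ENNReal.ofReal (prior lam) = 1

/-- A prior density of the pair `(lam, ζ)` on `Θ × Z`, for the canonical posterior in which `ζ` is
not conditionally deterministic. Its mass has to be finite only for bounded `ζ`, so that both a
probability density and the choice `prior lam` (where the law of `ζ` is part of `L`) are allowed. -/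
structure JointPrior {𝒴 : Type*} {d p : ℕ} (M : Model 𝒴 d p) where
  density : Vec d × Vec p → ℝ
  density_nonneg : ∀ x, 0 ≤ density x
  density_measurable : Measurable density
  finite_of_bounded : ∀ R : ℝ,
    ∫⁻ x in M.Θ ×ˢ (M.Z ∩ Metric.ball 0 R), ENNReal.ofReal (density x) < ⊤

/-- The joint prior is a finite measure (equivalently, after normalization, a probability). -/
def JointPrior.IsProper {𝒴 : Type*} {d p : ℕ} {M : Model 𝒴 d p} (ρ : JointPrior M) : Prop :=
  ∫⁻ x in M.Θ ×ˢ M.Z, ENNReal.ofReal (ρ.density x) < ⊤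

/-- Scale a measure to total mass one. -/
def normalize {α : Type*} [MeasurableSpace α] (μ : Measure α) : Measure α :=
  (μ Set.univ)⁻¹ • μ

namespace Model

variable {𝒴 : Type*} {d p : ℕ}

/-- `lₙ(lam, ζ) = log L(y₁,…,yₙ, ζ; lam) / n`, for the data sequence `y`. -/
def ell (M : Model 𝒴 d p) (y : ℕ → 𝒴) (n : ℕ) (lam : Vec d) (ζ : Vec p) : ℝ :=
  Real.log (M.L n (fun i => y i) lam ζ) / n

/-- `ẑₙ(lam) = argmin_ζ gₙ(ζ, y₁,…,yₙ; lam)`. -/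
def zhat (M : Model 𝒴 d p) (y : ℕ → 𝒴) (n : ℕ) (lam : Vec d) : Vec p :=
  argminOn (M.g n (fun i => y i) lam) M.Z

/-- `l̂ₙ(lam) = lₙ(lam, ẑₙ(lam))`. -/
def ellHat (M : Model 𝒴 d p) (y : ℕ → 𝒴) (n : ℕ) (lam : Vec d) : ℝ :=
  M.ell y n lam (M.zhat y n lam)

/-- The conditionally deterministic latent variable is well defined: the minimizer exists and is
unique for every `lam ∈ Θ`, and it is a measurable function of `lam`. -/
def WellPosed (M : Model 𝒴 d p) (y : ℕ → 𝒴) : Prop :=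
  ∀ n : ℕ, 0 < n →
    (∀ lam ∈ M.Θ, HasUniqueMin (M.g n (fun i => y i) lam) M.Z) ∧
    AEMeasurable (M.zhat y n) (volume.restrict M.Θ)

/-- The loss is minus the likelihood, so that `L(y, ẑₙ(lam); lam)` is the profile likelihood. -/
def IsProfile (M : Model 𝒴 d p) : Prop :=
  ∀ n y lam ζ, M.g n y lam ζ = -M.L n y lam ζ

/-- The bridged posterior: the law on `Θ` with density proportional to
`prior lam * L(y₁,…,yₙ, ẑₙ(lam); lam)`. -/
def bridgedPosterior (M : Model 𝒴 d p) (y : ℕ → 𝒴) (n : ℕ) : Measure (Vec d) :=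
  normalize ((volume.restrict M.Θ).withDensity fun lam =>
    ENNReal.ofReal (M.prior lam * M.L n (fun i => y i) lam (M.zhat y n lam)))

/-- The canonical (full) posterior of `(lam, ζ)`: the law on `Θ × Z` with density proportional to
`ρ(lam, ζ) * L(y₁,…,yₙ, ζ; lam)`. -/
def fullPosterior (M : Model 𝒴 d p) (ρ : JointPrior M) (y : ℕ → 𝒴) (n : ℕ) :
    Measure (Vec d × Vec p) :=
  normalize ((volume.restrict (M.Θ ×ˢ M.Z)).withDensity fun x =>
    ENNReal.ofReal (ρ.density x * M.L n (fun i => y i) x.1 x.2))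

/-- The law of `√n (ẑₙ(lam) - ẑₙ(lamₙ))` when `lam` follows the bridged posterior. -/
def bridgedLatentLaw (M : Model 𝒴 d p) (y : ℕ → 𝒴) (lamn : ℕ → Vec d) (n : ℕ) :
    Measure (Vec p) :=
  (M.bridgedPosterior y n).map fun lam =>
    Real.sqrt n • (M.zhat y n lam - M.zhat y n (lamn n))

/-- The law of `√n (ζ - ẑₙ(lamₙ))` when `(lam, ζ)` follows the full posterior. -/
def fullLatentLaw (M : Model 𝒴 d p) (ρ : JointPrior M) (y : ℕ → 𝒴) (lamn : ℕ → Vec d) (n : ℕ) :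
    Measure (Vec p) :=
  (M.fullPosterior ρ y n).map fun x => Real.sqrt n • (x.2 - M.zhat y n (lamn n))

/-- (A1) for the data sequence `y`. The domain `E × ẑₙ(E)` of `lₙ` is read as `E × Uₙ` with an open
set `Uₙ ⊇ ẑₙ(E)` that does not shrink around any of the points `ẑₙ(lam)` as `n` grows (one can take
`Uₙ = ẑₙ(E)` if that set has these properties). -/
def A1 (M : Model 𝒴 d p) (E : Set (Vec d)) (y : ℕ → 𝒴) : Prop :=
  (∃ U : ℕ → Set (Vec p),
    (∀ n, 0 < n → IsOpen (U n) ∧ U n ⊆ M.Z ∧ M.zhat y n '' E ⊆ U n) ∧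
    (∀ lam ∈ E, ∃ r > 0, ∀ n, 0 < n → Metric.ball (M.zhat y n lam) r ⊆ U n) ∧
    (∀ n, 0 < n →
      ContDiffOn ℝ 3 (fun x : Vec d × Vec p => M.ell y n x.1 x.2) (E ×ˢ U n)) ∧
    ∃ C : ℝ, ∀ n, 0 < n → ∀ x ∈ E ×ˢ U n,
      ‖iteratedFDeriv ℝ 3 (fun x : Vec d × Vec p => M.ell y n x.1 x.2) x‖ ≤ C) ∧
  (∀ n, 0 < n → ContDiffOn ℝ 3 (M.zhat y n) E) ∧
  ∃ C : ℝ, ∀ n, 0 < n → ∀ lam ∈ E, ‖iteratedFDeriv ℝ 3 (M.zhat y n) lam‖ ≤ C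

/-- (A2) for the data sequence `y`: pointwise convergence of `ẑₙ` on `Θ` and of `lₙ` on `Θ × Z`. -/
def A2 (M : Model 𝒴 d p) (zstar : Vec d → Vec p) (lstar : Vec d × Vec p → ℝ) (y : ℕ → 𝒴) : Prop :=
  (∀ lam ∈ M.Θ, Tendsto (fun n => M.zhat y n lam) atTop (𝓝 (zstar lam))) ∧
  ∀ lam ∈ M.Θ, ∀ ζ ∈ M.Z, Tendsto (fun n => M.ell y n lam ζ) atTop (𝓝 (lstar (lam, ζ)))

/-- The second half of (A4) for the data sequence `y`:
`limsupₙ sup {lₙ(lam, ζ) | lam ∈ Θ \ K, ζ ∈ ẑₙ(Θ)} < c₀`. -/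
def A4Outside (M : Model 𝒴 d p) (K : Set (Vec d)) (c₀ : ℝ) (y : ℕ → 𝒴) : Prop :=
  ∃ c < c₀, ∀ᶠ n in atTop, ∀ lam ∈ M.Θ \ K, ∀ ζ ∈ M.zhat y n '' M.Θ, M.ell y n lam ζ ≤ c

/-- The centering sequences of the Bernstein–von Mises theorem: `lamₙ → lam₀`, and
`l̂ₙ'(lamₙ) = 0` for all large `n`. -/
def IsCenter (M : Model 𝒴 d p) (lam₀ : Vec d) (y : ℕ → 𝒴) (lamn : ℕ → Vec d) : Prop :=
  Tendsto lamn atTop (𝓝 lam₀) ∧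
  ∀ᶠ n in atTop, HasFDerivAt (M.ellHat y n) (0 : Vec d →L[ℝ] ℝ) (lamn n)

/-- `lₙ` is eventually separated from `c₀` uniformly over `{ζ : ‖ζ - ζ₀‖ ≥ ε}`, for every `ε > 0`:
`limsupₙ sup {lₙ(lam, ζ) | lam ∈ Θ, ζ ∈ Z, ‖ζ - ζ₀‖ ≥ ε} < c₀`. -/
def SeparatedInLatent (M : Model 𝒴 d p) (ζ₀ : Vec p) (c₀ : ℝ) (y : ℕ → 𝒴) : Prop :=
  ∀ ε > 0, ∃ c < c₀, ∀ᶠ n in atTop, ∀ lam ∈ M.Θ, ∀ ζ ∈ M.Z, ε ≤ ‖ζ - ζ₀‖ → M.ell y n lam ζ ≤ c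

end Model

/-- (A3): at `(lam₀, ẑ_*(lam₀))`, minus the second derivative of `l_*` is positive definite, and the
partial derivative of `l_*` in `ζ` vanishes. -/
def A3 {d p : ℕ} (lam₀ : Vec d) (zstar : Vec d → Vec p) (lstar : Vec d × Vec p → ℝ) : Prop :=
  (∀ v : Vec d × Vec p, v ≠ 0 → 0 < -(iteratedFDeriv ℝ 2 lstar (lam₀, zstar lam₀) ![v, v])) ∧
  HasFDerivAt (fun ζ => lstar (lam₀, ζ)) (0 : Vec p →L[ℝ] ℝ) (zstar lam₀)

/-- The first half of (A4): `l_*(lam, ζ) < l_*(lam₀, ẑ_*(lam₀))` for all `lam ∈ K \ {lam₀}` and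
`ζ ∈ ẑ_*(E)`. -/
def A4Inside {d p : ℕ} (K E : Set (Vec d)) (lam₀ : Vec d) (zstar : Vec d → Vec p)
    (lstar : Vec d × Vec p → ℝ) : Prop :=
  ∀ lam ∈ K \ {lam₀}, ∀ ζ ∈ zstar '' E, lstar (lam, ζ) < lstar (lam₀, zstar lam₀)

/-- The laws `μ n` of a sequence of random vectors converge weakly to a probability law whose
`j`-th coordinate has the (finite) variance `v j`, for every `j`: the asymptotic variance of the
`j`-th element of the random vectors is `v j`. -/
def HasAsymptoticVariance {k : ℕ} (μ : ℕ → Measure (Vec k)) (v : Fin k → ℝ) : Prop :=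
  ∃ ν : Measure (Vec k), IsProbabilityMeasure ν ∧
    (∀ f : Vec k →ᵇ ℝ, Tendsto (fun n => ∫ x, f x ∂μ n) atTop (𝓝 (∫ x, f x ∂ν))) ∧
    ∀ j, MemLp (fun x : Vec k => x j) 2 ν ∧ variance (fun x : Vec k => x j) ν = v j

end Bridged

end

/-!
Let `x₀ = (lam₀, ζ₀)` with `ζ₀ = ẑ_*(lam₀)`, and fix a data sequence from the almost sure event on which
all assumptions hold. Write `A` for the quadratic form `-l_*''(x₀)` and `J` for the derivative
`ẑ_*'(lam₀)`.

*Derivatives converge.* Near `x₀` the functions `lₙ` converge pointwise and have uniformly bounded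
third derivatives, and so do the `ẑₙ` near `lam₀`. By the Taylor formula their first and second
derivatives converge as well, continuously in the base point (`UniformlyC3.tendsto_prod_fderiv`,
`UniformlyC3.tendsto_prod_hessian`).

*Profiling.* Since `ẑₙ(lam)` maximizes `lₙ(lam, ·)`, the derivative of `lₙ` in `ζ` vanishes on the graph
of `ẑₙ`. Hence a critical point `lamₙ` of the profile log-likelihood gives a critical point
`xₙ = (lamₙ, ẑₙ(lamₙ))` of `lₙ` itself, and differentiating once more along the graph shows that the
vectors `(u, J u)` are `A`-orthogonal to the vectors `(0, ξ)`
(`RegularData.hessian_graph_eq_zero`). Expanding `lₙ` at `xₙ` gives a quadratic upper bound on a fixed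
ball and the limit `-A / 2` on the scale `n^(-1/2)`. The profile log-likelihood is the restriction of
`lₙ` to the graph, so it inherits both, with the form `u ↦ A (u, J u)`.

*Laplace's method.* Under such a local expansion, a posterior whose mass away from the center is
negligible converges, after rescaling, to the Gaussian law whose precision is the limiting form
(`LaplaceFamily.tendsto_integral_normalize`). For the bridged posterior the mass far away is
exponentially small by compactness of `K` and the two parts of `A4`. For the full posterior, the same
bound handles `lam` far from `lam₀`, because `lₙ(lam, ζ) ≤ l̂ₙ(lam)`; for `ζ` far from `ζ₀` one uses
separation in `ζ` together with properness of the prior, or else the tightness implied by the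
convergence of the laws that is assumed (`RegularData.tendsto_far_of_hasAsymptoticVariance`).

*Comparison.* The limits are the law of `J u` for `u` Gaussian with precision `A (u, J u)`, and the law
of the `ζ`-component of a Gaussian vector with precision `A`. By orthogonality
`A (u, J u + ξ) = A (u, J u) + A (0, ξ)`, so the latter is the law of `J u + ξ` with an independent
nondegenerate `ξ`, whose variance is the strictly positive gap (`variance_gaussLaw_lt`).
-/

/-! ### Limits of functions with uniformly bounded third derivatives -/

namespace Bridged

variable {V F : Type*} [NormedAddCommGroup V] [NormedSpace ℝ V]
  [NormedAddCommGroup F] [NormedSpace ℝ F]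

theorem norm_sub_taylor_one_le {f : V → F} {f' : V → V →L[ℝ] F} {s : Set V} {C : ℝ}
    (hs : Convex ℝ s) (hC : 0 ≤ C) (hf : ∀ x ∈ s, HasFDerivAt f (f' x) x)
    (hlip : ∀ x ∈ s, ∀ y ∈ s, ‖f' y - f' x‖ ≤ C * ‖y - x‖) {x y : V} (hx : x ∈ s) (hy : y ∈ s) :
    ‖f y - f x - f' x (y - x)‖ ≤ C * ‖y - x‖ ^ 2 := by
  have hsub : segment ℝ x y ⊆ s := hs.segment_subset hx hy
  have := (convex_segment (𝕜 := ℝ) x y).norm_image_sub_le_of_norm_hasFDerivWithin_le'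
    (f := f) (f' := f') (φ := f' x) (C := C * ‖y - x‖)
    (fun z hz => (hf z (hsub hz)).hasFDerivWithinAt)
    (fun z hz => (hlip x hx z (hsub hz)).trans
      (mul_le_mul_of_nonneg_left (norm_sub_le_of_mem_segment hz) hC))
    (left_mem_segment ℝ x y) (right_mem_segment ℝ x y)
  calc _ ≤ _ := this
    _ = _ := by ring

theorem norm_sub_taylor_two_le {f : V → F} {f' : V → V →L[ℝ] F} {f'' : V → V →L[ℝ] V →L[ℝ] F}
    {s : Set V} {C : ℝ} (hs : Convex ℝ s) (hC : 0 ≤ C) (hf : ∀ x ∈ s, HasFDerivAt f (f' x) x)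
    (hf' : ∀ x ∈ s, HasFDerivAt f' (f'' x) x)
    (hsymm : ∀ x ∈ s, ∀ u v, f'' x u v = f'' x v u)
    (hlip : ∀ x ∈ s, ∀ y ∈ s, ‖f'' y - f'' x‖ ≤ C * ‖y - x‖) {x y : V} (hx : x ∈ s) (hy : y ∈ s) :
    ‖f y - f x - f' x (y - x) - (1 / 2 : ℝ) • f'' x (y - x) (y - x)‖ ≤ C * ‖y - x‖ ^ 3 := by
  have hsub : segment ℝ x y ⊆ s := hs.segment_subset hx hy
  have hder : ∀ z ∈ s, HasFDerivAt (fun z => f z - (1 / 2 : ℝ) • f'' x (z - x) (z - x))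
      (f' z - f'' x (z - x)) z := by
    intro z hz
    have h1 : HasFDerivAt (fun z : V => z - x) (ContinuousLinearMap.id ℝ V) z :=
      (hasFDerivAt_id z).sub_const x
    have h2 := ((((f'' x).hasFDerivAt (x := z - x)).comp z h1).clm_apply h1).const_smul (1 / 2 : ℝ)
    convert (hf z hz).sub h2 using 1
    · rfl
    ext u
    simp only [sub_apply, smul_apply, add_apply, ContinuousLinearMap.comp_apply,
      ContinuousLinearMap.flip_apply, ContinuousLinearMap.id_apply, Function.comp_apply]
    rw [hsymm x hx u (z - x), ← two_smul ℝ, smul_smul]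
    norm_num
  have := (convex_segment (𝕜 := ℝ) x y).norm_image_sub_le_of_norm_hasFDerivWithin_le'
    (f := fun z => f z - (1 / 2 : ℝ) • f'' x (z - x) (z - x))
    (f' := fun z => f' z - f'' x (z - x)) (φ := f' x) (C := C * ‖y - x‖ ^ 2)
    (fun z hz => (hder z (hsub hz)).hasFDerivWithinAt)
    (fun z hz => by
      have h := norm_sub_taylor_one_le hs hC hf' hlip hx (hsub hz)
      rw [sub_right_comm]
      refine h.trans (mul_le_mul_of_nonneg_left ?_ hC)
      gcongr
      exact norm_sub_le_of_mem_segment hz)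
    (left_mem_segment ℝ x y) (right_mem_segment ℝ x y)
  calc _ = _ := by
        congr 1
        simp only [sub_self, map_zero, smul_zero, sub_zero]
        abel
    _ ≤ _ := this
    _ = _ := by ring

/-- In finite dimensions, pointwise convergence of linear maps is convergence in norm. -/
theorem tendsto_clm_of_tendsto_apply [FiniteDimensional ℝ V] {ι : Type*} {l : Filter ι}
    {g : ι → V →L[ℝ] F} {g₀ : V →L[ℝ] F} (h : ∀ v, Tendsto (fun i => g i v) l (𝓝 (g₀ v))) :
    Tendsto g l (𝓝 g₀) := by
  let b := Module.finBasis ℝ V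
  have key : ∀ g : V →L[ℝ] F, g = ∑ i,
      ContinuousLinearMap.smulRightL ℝ V F (LinearMap.toContinuousLinearMap (b.coord i)) (g (b i)) := by
    intro g
    ext v
    conv_lhs => rw [← b.sum_repr v, map_sum]
    simp
  rw [key g₀, funext fun i => key (g i)]
  exact tendsto_finsetSum _ fun i _ => ((ContinuousLinearMap.continuous _).tendsto _).comp (h _)

/-- If the derivatives of a pointwise convergent sequence are Lipschitz with a common constant, then
they converge pointwise, to the derivative of the limit. -/
theorem tendsto_fderiv_of_lipschitz [FiniteDimensional ℝ V] [CompleteSpace F]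
    {f : ℕ → V → F} {g : V → F} {s : Set V} {C : ℝ} (hs : Convex ℝ s) (hso : IsOpen s)
    (hC : 0 ≤ C)
    (hf : ∀ᶠ n in atTop, (∀ x ∈ s, HasFDerivAt (f n) (fderiv ℝ (f n) x) x) ∧
      ∀ x ∈ s, ∀ y ∈ s, ‖fderiv ℝ (f n) y - fderiv ℝ (f n) x‖ ≤ C * ‖y - x‖)
    (hlim : ∀ x ∈ s, Tendsto (fun n => f n x) atTop (𝓝 (g x))) {x : V} (hx : x ∈ s) :
    HasFDerivAt g (fderiv ℝ g x) x ∧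
      Tendsto (fun n => fderiv ℝ (f n) x) atTop (𝓝 (fderiv ℝ g x)) := by
  have htay : ∀ᶠ n in atTop, ∀ y ∈ s,
      ‖f n y - f n x - fderiv ℝ (f n) x (y - x)‖ ≤ C * ‖y - x‖ ^ 2 := by
    filter_upwards [hf] with n hn y hy using norm_sub_taylor_one_le hs hC hn.1 hn.2 hx hy
  obtain ⟨r, hr, hrs⟩ := Metric.isOpen_iff.1 hso x hx
  -- difference quotients with a small fixed step converge, and approximate the derivatives
  have hcau : ∀ v, CauchySeq fun n => fderiv ℝ (f n) x v := by
    intro v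
    rw [Metric.cauchySeq_iff']
    intro ε hε
    obtain ⟨t, ht0, ht1, ht2⟩ : ∃ t : ℝ, 0 < t ∧ t * ‖v‖ < r ∧ t * (C * ‖v‖ ^ 2) < ε / 6 := by
      have h1 : Tendsto (fun t : ℝ => t * ‖v‖) (𝓝[>] 0) (𝓝 (0 * ‖v‖)) :=
        (tendsto_nhdsWithin_of_tendsto_nhds tendsto_id).mul_const _
      have h2 : Tendsto (fun t : ℝ => t * (C * ‖v‖ ^ 2)) (𝓝[>] 0) (𝓝 (0 * (C * ‖v‖ ^ 2))) :=
        (tendsto_nhdsWithin_of_tendsto_nhds tendsto_id).mul_const _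
      rw [zero_mul] at h1 h2
      have := (h1.eventually_lt_const hr).and (h2.eventually_lt_const (by positivity : 0 < ε / 6))
      obtain ⟨t, ⟨h3, h4⟩, h5⟩ := (this.and self_mem_nhdsWithin).exists
      exact ⟨t, h5, h3, h4⟩
    have hy : x + t • v ∈ s := hrs (by
      rw [Metric.mem_ball, dist_eq_norm, add_sub_cancel_left, norm_smul, Real.norm_of_nonneg ht0.le]
      exact ht1)
    have hq := ((hlim _ hy).sub (hlim _ hx)).cauchySeq
    rw [Metric.cauchySeq_iff'] at hq
    obtain ⟨N, hN⟩ := hq (t * ε / 6) (by positivity)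
    obtain ⟨N', hN'⟩ := eventually_atTop.1 htay
    have hN2 : ∀ n ≥ N, dist (f n (x + t • v) - f n x) (f (max N N') (x + t • v) - f (max N N') x)
        < t * ε / 3 := by
      intro n hn
      have h1 := hN n hn
      have h2 := hN (max N N') (le_max_left _ _)
      rw [dist_comm] at h2
      linarith [dist_triangle (f n (x + t • v) - f n x) (f N (x + t • v) - f N x)
        (f (max N N') (x + t • v) - f (max N N') x)]
    refine ⟨max N N', fun n hn => ?_⟩
    have h1 := hN2 n ((le_max_left _ _).trans hn)
    have h2 := hN' n ((le_max_right _ _).trans hn) _ hy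
    have h3 := hN' (max N N') (le_max_right _ _) _ hy
    rw [add_sub_cancel_left, map_smul, norm_smul, Real.norm_of_nonneg ht0.le] at h2 h3
    rw [dist_eq_norm] at h1 ⊢
    set m := max N N'
    have h4 : t * ‖fderiv ℝ (f n) x v - fderiv ℝ (f m) x v‖ < t * ε := by
      rw [← Real.norm_of_nonneg ht0.le, ← norm_smul, Real.norm_of_nonneg ht0.le]
      calc ‖t • (fderiv ℝ (f n) x v - fderiv ℝ (f m) x v)‖
          = ‖(f n (x + t • v) - f n x - (f m (x + t • v) - f m x))
            - (f n (x + t • v) - f n x - t • fderiv ℝ (f n) x v)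
            + (f m (x + t • v) - f m x - t • fderiv ℝ (f m) x v)‖ := by
              congr 1; rw [smul_sub]; abel
        _ ≤ _ := (norm_add_le _ _).trans (add_le_add_left (norm_sub_le _ _) _)
        _ < t * ε := by nlinarith
    exact lt_of_mul_lt_mul_left h4 ht0.le
  choose g' hg' using fun v => cauchySeq_tendsto_of_complete (hcau v)
  -- the pointwise limit of the derivatives is linear
  let G : V →L[ℝ] F := LinearMap.toContinuousLinearMap
    { toFun := g'
      map_add' := fun u v => tendsto_nhds_unique (hg' (u + v))
        (by simpa only [map_add] using (hg' u).add (hg' v))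
      map_smul' := fun c v => tendsto_nhds_unique (hg' (c • v))
        (by simpa only [map_smul, RingHom.id_apply] using (hg' v).const_smul c) }
  have hG : Tendsto (fun n => fderiv ℝ (f n) x) atTop (𝓝 G) := tendsto_clm_of_tendsto_apply hg'
  have hder : HasFDerivAt g G x := by
    have hO : (fun y => g y - g x - G (y - x)) =O[𝓝 x] fun y => ‖y - x‖ ^ 2 := by
      refine Asymptotics.IsBigO.of_bound C ?_
      filter_upwards [hso.mem_nhds hx] with y hy
      rw [Real.norm_of_nonneg (by positivity)]
      exact le_of_tendsto (((hlim y hy).sub (hlim x hx)).sub (hg' (y - x))).norm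
        (htay.mono fun n hn => hn y hy)
    rw [hasFDerivAt_iff_isLittleO]
    refine hO.trans_isLittleO ?_
    have h0 : (fun y : V => ‖y - x‖) =o[𝓝 x] fun _ => (1 : ℝ) := by
      rw [Asymptotics.isLittleO_one_iff]
      have : Continuous fun y : V => ‖y - x‖ := by fun_prop
      simpa using this.tendsto x
    have h1 : (fun y : V => ‖y - x‖) =O[𝓝 x] fun y => y - x :=
      (Asymptotics.isBigO_refl (fun y : V => y - x) (𝓝 x)).norm_left
    simpa [pow_two] using (h0.mul_isBigO h1.norm_right).norm_right
  rw [hder.fderiv]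
  exact ⟨hder, hG⟩

/-- Eventually in `n`, the functions `f n` are `C³` on the ball `B(x₀, r)` with a common bound on
their third derivatives, and they converge to `g` pointwise on this ball. -/
structure UniformlyC3 (f : ℕ → V → F) (g : V → F) (x₀ : V) (r : ℝ) : Prop where
  pos : 0 < r
  bound : ∃ C : ℝ, ∀ᶠ n in atTop, ContDiffOn ℝ 3 (f n) (Metric.ball x₀ r) ∧
    ∀ x ∈ Metric.ball x₀ r, ‖iteratedFDeriv ℝ 3 (f n) x‖ ≤ C
  tendsto : ∀ x ∈ Metric.ball x₀ r, Tendsto (fun n => f n x) atTop (𝓝 (g x))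

/-- `f` is twice differentiable on `s`, with symmetric second derivative, Lipschitz with
constant `C`. -/
structure HasLipschitzHessian (f : V → F) (s : Set V) (C : ℝ) : Prop where
  hasFDerivAt : ∀ x ∈ s, HasFDerivAt f (fderiv ℝ f x) x
  hasFDerivAt_fderiv : ∀ x ∈ s, HasFDerivAt (fderiv ℝ f) (fderiv ℝ (fderiv ℝ f) x) x
  symm : ∀ x ∈ s, ∀ u v, fderiv ℝ (fderiv ℝ f) x u v = fderiv ℝ (fderiv ℝ f) x v u
  lipschitz : ∀ x ∈ s, ∀ y ∈ s,
    ‖fderiv ℝ (fderiv ℝ f) y - fderiv ℝ (fderiv ℝ f) x‖ ≤ C * ‖y - x‖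

theorem _root_.ContDiffOn.hasFDerivAt_fderiv_of_isOpen {f : V → F} {s : Set V} {m : WithTop ℕ∞}
    (hf : ContDiffOn ℝ m f s) (hso : IsOpen s) (hm : m ≠ 0) :
    ∀ x ∈ s, HasFDerivAt f (fderiv ℝ f x) x :=
  fun _ hx => ((hf.contDiffAt (hso.mem_nhds hx)).differentiableAt hm).hasFDerivAt

theorem _root_.ContDiffOn.hasLipschitzHessian {f : V → F} {s : Set V} {C : ℝ} (hf : ContDiffOn ℝ 3 f s)
    (hs : Convex ℝ s) (hso : IsOpen s) (hC : ∀ x ∈ s, ‖iteratedFDeriv ℝ 3 f x‖ ≤ C) :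
    HasLipschitzHessian f s C := by
  have h2 : ContDiffOn ℝ 2 (fderiv ℝ f) s := hf.fderiv_of_isOpen hso (by norm_num)
  have h1 : ContDiffOn ℝ 1 (fderiv ℝ (fderiv ℝ f)) s := h2.fderiv_of_isOpen hso (by norm_num)
  refine ⟨hf.hasFDerivAt_fderiv_of_isOpen hso (by norm_num),
    h2.hasFDerivAt_fderiv_of_isOpen hso (by norm_num), fun x hx u v => ?_, fun x hx y hy => ?_⟩
  · exact ((hf.contDiffAt (hso.mem_nhds hx)).isSymmSndFDerivAt
      (by rw [minSmoothness_of_isRCLikeNormedField]; exact_mod_cast (by norm_num : (2 : ℕ) ≤ 3))).eq u v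
  · refine hs.norm_image_sub_le_of_norm_hasFDerivWithin_le (f := fderiv ℝ (fderiv ℝ f))
      (fun z hz => (h1.hasFDerivAt_fderiv_of_isOpen hso one_ne_zero z hz).hasFDerivWithinAt) (fun z hz => ?_) hx hy
    have := hC z hz
    rwa [← norm_iteratedFDeriv_fderiv, ← norm_iteratedFDeriv_fderiv,
      ← norm_iteratedFDeriv_fderiv, norm_iteratedFDeriv_zero] at this

theorem HasLipschitzHessian.taylor {f : V → F} {s : Set V} {C : ℝ} (h : HasLipschitzHessian f s C)
    (hs : Convex ℝ s) (hC : 0 ≤ C) {x y : V} (hx : x ∈ s) (hy : y ∈ s) :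
    ‖f y - f x - fderiv ℝ f x (y - x) - (1 / 2 : ℝ) • fderiv ℝ (fderiv ℝ f) x (y - x) (y - x)‖
      ≤ C * ‖y - x‖ ^ 3 :=
  norm_sub_taylor_two_le hs hC h.hasFDerivAt h.hasFDerivAt_fderiv h.symm h.lipschitz hx hy

namespace UniformlyC3

variable {f : ℕ → V → F} {g : V → F} {x₀ : V} {r : ℝ}

theorem exists_hasLipschitzHessian (h : UniformlyC3 f g x₀ r) :
    ∃ C, 0 ≤ C ∧ ∀ᶠ n in atTop, HasLipschitzHessian (f n) (Metric.ball x₀ r) C := by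
  obtain ⟨C, hC⟩ := h.bound
  refine ⟨max C 0, le_max_right _ _, hC.mono fun n hn => ?_⟩
  exact hn.1.hasLipschitzHessian (convex_ball _ _) Metric.isOpen_ball
    fun x hx => (hn.2 x hx).trans (le_max_left _ _)

/-- Second differences of the convergent sequence `f n` at `x₀` are bounded; by the Taylor formula
and polarization so are the values of the bilinear forms `D²(f n)(x₀)`, and hence, by the uniform
boundedness principle, their norms. -/
theorem exists_norm_hessian_center_le [CompleteSpace V] (h : UniformlyC3 f g x₀ r) :
    ∃ B, ∀ᶠ n in atTop, ‖fderiv ℝ (fderiv ℝ (f n)) x₀‖ ≤ B := by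
  obtain ⟨C, hC, hev⟩ := h.exists_hasLipschitzHessian
  obtain ⟨N, hN⟩ := eventually_atTop.1 hev
  have hx₀ : x₀ ∈ Metric.ball x₀ r := Metric.mem_ball_self h.pos
  let D : Set.Ici N → V →L[ℝ] V →L[ℝ] F := fun n => fderiv ℝ (fderiv ℝ (f n)) x₀
  have hsmall : ∀ v : V, ‖v‖ < r → ∃ B, ∀ n : Set.Ici N, ‖D n v v‖ ≤ B := by
    intro v hv
    have hp : x₀ + v ∈ Metric.ball x₀ r := by simpa [dist_eq_norm] using hv
    have hm : x₀ - v ∈ Metric.ball x₀ r := by simpa [dist_eq_norm] using hv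
    obtain ⟨B, hB⟩ := (Metric.isBounded_range_of_tendsto _
      (((h.tendsto _ hp).add (h.tendsto _ hm)).sub
        ((h.tendsto _ hx₀).const_smul (2 : ℝ)))).exists_norm_le
    refine ⟨B + 2 * (C * ‖v‖ ^ 3), fun n => ?_⟩
    have h0 := hB _ ⟨n.1, rfl⟩
    have h1 := (hN n.1 n.2).taylor (convex_ball _ _) hC hx₀ hp
    have h2 := (hN n.1 n.2).taylor (convex_ball _ _) hC hx₀ hm
    rw [add_sub_cancel_left] at h1
    rw [sub_sub_cancel_left, norm_neg] at h2
    simp only [map_neg, neg_apply, neg_neg] at h2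
    calc ‖D n v v‖ = ‖(f n (x₀ + v) + f n (x₀ - v) - (2 : ℝ) • f n x₀)
          - (f n (x₀ + v) - f n x₀ - fderiv ℝ (f n) x₀ v - (1 / 2 : ℝ) • D n v v)
          - (f n (x₀ - v) - f n x₀ - -fderiv ℝ (f n) x₀ v - (1 / 2 : ℝ) • D n v v)‖ := by
            congr 1; module
      _ ≤ _ := (norm_sub_le _ _).trans (add_le_add_left (norm_sub_le _ _) _)
      _ ≤ B + C * ‖v‖ ^ 3 + C * ‖v‖ ^ 3 := by gcongr
      _ = _ := by ring
  have hquad : ∀ v : V, ∃ B, ∀ n : Set.Ici N, ‖D n v v‖ ≤ B := by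
    intro v
    obtain ⟨t, ht, htv⟩ : ∃ t : ℝ, 0 < t ∧ t * ‖v‖ < r :=
      ⟨r / (‖v‖ + 1), by have := h.pos; positivity, by
        rw [div_mul_eq_mul_div, div_lt_iff₀ (by positivity)]
        nlinarith [h.pos, norm_nonneg v]⟩
    obtain ⟨B, hB⟩ := hsmall (t • v) (by rwa [norm_smul, Real.norm_of_nonneg ht.le])
    refine ⟨B / (t * t), fun n => ?_⟩
    have := hB n
    simp only [map_smul, smul_apply, norm_smul, Real.norm_of_nonneg ht.le,
      ← mul_assoc] at this
    rw [le_div_iff₀ (by positivity)]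
    linarith
  have hbil : ∀ u v : V, ∃ B, ∀ n : Set.Ici N, ‖D n u v‖ ≤ B := by
    intro u v
    obtain ⟨B₁, h₁⟩ := hquad (u + v)
    obtain ⟨B₂, h₂⟩ := hquad (u - v)
    refine ⟨(1 / 4) * (B₁ + B₂), fun n => ?_⟩
    have hs : D n v u = D n u v := (hN n.1 n.2).symm x₀ hx₀ v u
    have : D n u v = (1 / 4 : ℝ) • (D n (u + v) (u + v) - D n (u - v) (u - v)) := by
      simp only [map_add, map_sub, add_apply, sub_apply, hs]
      module
    rw [this, norm_smul, Real.norm_of_nonneg (by norm_num)]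
    gcongr
    exact (norm_sub_le _ _).trans (add_le_add (h₁ n) (h₂ n))
  obtain ⟨B, hB⟩ := banach_steinhaus (g := D) fun u => banach_steinhaus (g := fun n => D n u) (hbil u)
  exact ⟨B, eventually_atTop.2 ⟨N, fun n hn => hB ⟨n, hn⟩⟩⟩

theorem exists_norm_hessian_le [CompleteSpace V] (h : UniformlyC3 f g x₀ r) :
    ∃ B, 0 ≤ B ∧ ∀ᶠ n in atTop, ∀ x ∈ Metric.ball x₀ r, ‖fderiv ℝ (fderiv ℝ (f n)) x‖ ≤ B := by
  obtain ⟨C, hC, hev⟩ := h.exists_hasLipschitzHessian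
  obtain ⟨B, hB⟩ := h.exists_norm_hessian_center_le
  refine ⟨max (B + C * r) 0, le_max_right _ _, ?_⟩
  filter_upwards [hev, hB] with n hn hBn x hx
  have h1 := hn.lipschitz x₀ (Metric.mem_ball_self h.pos) x hx
  have h2 : C * ‖x - x₀‖ ≤ C * r := by
    gcongr
    exact (mem_ball_iff_norm.1 hx).le
  have h3 := norm_sub_norm_le (fderiv ℝ (fderiv ℝ (f n)) x) (fderiv ℝ (fderiv ℝ (f n)) x₀)
  refine le_max_of_le_left ?_
  linarith

variable [FiniteDimensional ℝ V] [CompleteSpace F]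

theorem tendsto_fderiv (h : UniformlyC3 f g x₀ r) {x : V} (hx : x ∈ Metric.ball x₀ r) :
    HasFDerivAt g (fderiv ℝ g x) x ∧
      Tendsto (fun n => fderiv ℝ (f n) x) atTop (𝓝 (fderiv ℝ g x)) := by
  have := FiniteDimensional.complete ℝ V
  obtain ⟨C, hC, hev⟩ := h.exists_hasLipschitzHessian
  obtain ⟨B, hB, hBev⟩ := h.exists_norm_hessian_le
  refine tendsto_fderiv_of_lipschitz (convex_ball x₀ r) Metric.isOpen_ball hB ?_ h.tendsto hx
  filter_upwards [hev, hBev] with n hn hBn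
  exact ⟨hn.hasFDerivAt, fun x hx y hy =>
    (convex_ball x₀ r).norm_image_sub_le_of_norm_hasFDerivWithin_le
      (fun z hz => (hn.hasFDerivAt_fderiv z hz).hasFDerivWithinAt) hBn hx hy⟩

theorem tendsto_hessian (h : UniformlyC3 f g x₀ r) {x : V} (hx : x ∈ Metric.ball x₀ r) :
    Tendsto (fun n => fderiv ℝ (fderiv ℝ (f n)) x) atTop (𝓝 (fderiv ℝ (fderiv ℝ g) x)) := by
  obtain ⟨C, hC, hev⟩ := h.exists_hasLipschitzHessian
  refine (tendsto_fderiv_of_lipschitz (convex_ball x₀ r) Metric.isOpen_ball hC ?_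
    (fun y hy => (h.tendsto_fderiv hy).2) hx).2
  filter_upwards [hev] with n hn
  exact ⟨hn.hasFDerivAt_fderiv, hn.lipschitz⟩

end UniformlyC3

/-- A pointwise convergent sequence of uniformly Lipschitz functions converges continuously. -/
theorem tendsto_prod_of_lipschitz {X Y : Type*} [SeminormedAddCommGroup X] [SeminormedAddCommGroup Y]
    {f : ℕ → X → Y} {y₀ : Y} {x₀ : X} {r C : ℝ} (hr : 0 < r)
    (hlip : ∀ᶠ n in atTop, ∀ x ∈ Metric.ball x₀ r, ‖f n x - f n x₀‖ ≤ C * ‖x - x₀‖)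
    (h : Tendsto (fun n => f n x₀) atTop (𝓝 y₀)) :
    Tendsto (fun q : ℕ × X => f q.1 q.2) (atTop ×ˢ 𝓝 x₀) (𝓝 y₀) := by
  have h1 : Tendsto (fun q : ℕ × X => f q.1 q.2 - f q.1 x₀) (atTop ×ˢ 𝓝 x₀) (𝓝 0) := by
    refine squeeze_zero_norm' (a := fun q => C * ‖q.2 - x₀‖) ?_ ?_
    · filter_upwards [hlip.prod_mk (Metric.ball_mem_nhds x₀ hr)] with q hq using hq.1 _ hq.2
    · have : Continuous fun x : X => C * ‖x - x₀‖ := by fun_prop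
      have := this.tendsto x₀
      simp only [sub_self, norm_zero, mul_zero] at this
      exact this.comp tendsto_snd
  simpa using h1.add (h.comp tendsto_fst)

namespace UniformlyC3

variable {f : ℕ → V → F} {g : V → F} {x₀ : V} {r : ℝ} [FiniteDimensional ℝ V] [CompleteSpace F]

theorem tendsto_prod_hessian (h : UniformlyC3 f g x₀ r) :
    Tendsto (fun q : ℕ × V => fderiv ℝ (fderiv ℝ (f q.1)) q.2) (atTop ×ˢ 𝓝 x₀)
      (𝓝 (fderiv ℝ (fderiv ℝ g) x₀)) := by
  obtain ⟨C, hC, hev⟩ := h.exists_hasLipschitzHessian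
  have hx₀ : x₀ ∈ Metric.ball x₀ r := Metric.mem_ball_self h.pos
  exact tendsto_prod_of_lipschitz (f := fun n x => fderiv ℝ (fderiv ℝ (f n)) x) h.pos
    (hev.mono fun n hn x hx => hn.lipschitz x₀ hx₀ x hx) (h.tendsto_hessian hx₀)

omit [CompleteSpace F] in
theorem exists_lipschitz_fderiv (h : UniformlyC3 f g x₀ r) :
    ∃ B, 0 ≤ B ∧ ∀ᶠ n in atTop, ∀ x ∈ Metric.ball x₀ r, ∀ y ∈ Metric.ball x₀ r,
      ‖fderiv ℝ (f n) y - fderiv ℝ (f n) x‖ ≤ B * ‖y - x‖ := by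
  have := FiniteDimensional.complete ℝ V
  obtain ⟨C, hC, hev⟩ := h.exists_hasLipschitzHessian
  obtain ⟨B, hB, hBev⟩ := h.exists_norm_hessian_le
  refine ⟨B, hB, ?_⟩
  filter_upwards [hev, hBev] with n hn hBn x hx y hy
  exact (convex_ball x₀ r).norm_image_sub_le_of_norm_hasFDerivWithin_le
      (fun z hz => (hn.hasFDerivAt_fderiv z hz).hasFDerivWithinAt) hBn hx hy

theorem tendsto_prod_fderiv (h : UniformlyC3 f g x₀ r) :
    Tendsto (fun q : ℕ × V => fderiv ℝ (f q.1) q.2) (atTop ×ˢ 𝓝 x₀) (𝓝 (fderiv ℝ g x₀)) := by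
  obtain ⟨B, hB, hBev⟩ := h.exists_lipschitz_fderiv
  have hx₀ : x₀ ∈ Metric.ball x₀ r := Metric.mem_ball_self h.pos
  exact tendsto_prod_of_lipschitz (f := fun n x => fderiv ℝ (f n) x) h.pos
    (hBev.mono fun n hn x hx => hn x₀ hx₀ x hx) (h.tendsto_fderiv hx₀).2

theorem tendsto_prod (h : UniformlyC3 f g x₀ r) :
    Tendsto (fun q : ℕ × V => f q.1 q.2) (atTop ×ˢ 𝓝 x₀) (𝓝 (g x₀)) := by
  obtain ⟨C, hC, hev⟩ := h.exists_hasLipschitzHessian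
  have hx₀ : x₀ ∈ Metric.ball x₀ r := Metric.mem_ball_self h.pos
  have hb := h.tendsto_prod_fderiv.norm.eventually_lt_const (lt_add_one _)
  obtain ⟨p, hp, q, hq, hpq⟩ := eventually_prod_iff.1 hb
  obtain ⟨δ, hδ, hδq⟩ := Metric.eventually_nhds_iff_ball.1 hq
  refine tendsto_prod_of_lipschitz (C := ‖fderiv ℝ g x₀‖ + 1) (lt_min hδ h.pos) ?_
    (h.tendsto x₀ hx₀)
  filter_upwards [hev, hp] with n hn hpn x hx
  refine (convex_ball x₀ (min δ r)).norm_image_sub_le_of_norm_hasFDerivWithin_le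
      (fun z hz => (hn.hasFDerivAt z
        (Metric.ball_subset_ball (min_le_right _ _) hz)).hasFDerivWithinAt)
      (fun z hz => (hpq hpn (hδq z (Metric.ball_subset_ball (min_le_left _ _) hz))).le)
      (Metric.mem_ball_self (lt_min hδ h.pos)) hx

end UniformlyC3

end Bridged

/-! ### Quadratic expansions at critical points, and Gaussian laws -/

namespace Bridged

/-- A positive definite bilinear form on a finite-dimensional space is coercive. -/
theorem exists_mul_sq_norm_le {V : Type*} [NormedAddCommGroup V] [NormedSpace ℝ V]
    [FiniteDimensional ℝ V] (A : V →L[ℝ] V →L[ℝ] ℝ) (hA : ∀ v, v ≠ 0 → 0 < A v v) :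
    ∃ c > 0, ∀ v, c * ‖v‖ ^ 2 ≤ A v v := by
  have := FiniteDimensional.proper ℝ V
  rcases (Metric.sphere (0 : V) 1).eq_empty_or_nonempty with h | h
  · refine ⟨1, one_pos, fun v => ?_⟩
    have hv : v = 0 := by
      by_contra hv
      have : ‖v‖⁻¹ • v ∈ Metric.sphere (0 : V) 1 := by simp [norm_smul, hv]
      simp [h] at this
    simp [hv]
  · have hc : Continuous fun v => A v v := by fun_prop
    obtain ⟨e, he, hmin⟩ := (isCompact_sphere (0 : V) 1).exists_isMinOn h hc.continuousOn
    refine ⟨A e e, hA e (by rintro rfl; simp at he), fun v => ?_⟩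
    by_cases hv : v = 0
    · simp [hv]
    · have h1 : ‖v‖⁻¹ • v ∈ Metric.sphere (0 : V) 1 := by simp [norm_smul, hv]
      have h2 := isMinOn_iff.1 hmin _ h1
      have hpos : 0 < ‖v‖ := norm_pos_iff.2 hv
      simp only [map_smul, smul_apply, smul_eq_mul] at h2
      calc A e e * ‖v‖ ^ 2 ≤ ‖v‖⁻¹ * (‖v‖⁻¹ * A v v) * ‖v‖ ^ 2 := by gcongr
        _ = A v v := by field_simp

theorem tendsto_clm_apply {V F : Type*} [NormedAddCommGroup V] [NormedSpace ℝ V]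
    [NormedAddCommGroup F] [NormedSpace ℝ F] {ι : Type*} {l : Filter ι} {B : ι → V →L[ℝ] F}
    {B₀ : V →L[ℝ] F} {w : ι → V} {w₀ : V} (hB : Tendsto B l (𝓝 B₀)) (hw : Tendsto w l (𝓝 w₀)) :
    Tendsto (fun i => B i (w i)) l (𝓝 (B₀ w₀)) :=
  (isBoundedBilinearMap_apply.continuous.tendsto (B₀, w₀)).comp (hB.prodMk_nhds hw)

theorem tendsto_inv_sqrt_natCast : Tendsto (fun n : ℕ => (√(n : ℝ))⁻¹) atTop (𝓝 0) :=
  tendsto_inv_atTop_zero.comp (Real.tendsto_sqrt_atTop.comp tendsto_natCast_atTop_atTop)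

section Quadratic

variable {V : Type*} [NormedAddCommGroup V] [NormedSpace ℝ V] [FiniteDimensional ℝ V]
  {f : ℕ → V → ℝ} {g : V → ℝ} {x₀ : V} {r : ℝ} {x : ℕ → V}

/-- Near a nondegenerate limiting maximum, the functions `f n` lie below a fixed parabola with its
vertex at the critical point `x n`. -/
theorem UniformlyC3.exists_sub_le (h : UniformlyC3 f g x₀ r)
    (hneg : ∀ v, v ≠ 0 → 0 < -fderiv ℝ (fderiv ℝ g) x₀ v v) (hx : Tendsto x atTop (𝓝 x₀))
    (hcrit : ∀ᶠ n in atTop, fderiv ℝ (f n) (x n) = 0) :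
    ∃ c > 0, ∃ δ > 0, ∀ᶠ n in atTop, ∀ z ∈ Metric.ball x₀ δ,
      f n z - f n (x n) ≤ -(c * ‖z - x n‖ ^ 2) := by
  obtain ⟨c, hc, hcoer⟩ := exists_mul_sq_norm_le (-fderiv ℝ (fderiv ℝ g) x₀)
    (by simpa using hneg)
  obtain ⟨C, hC, hev⟩ := h.exists_hasLipschitzHessian
  have hH : Tendsto (fun n => fderiv ℝ (fderiv ℝ (f n)) (x n)) atTop
      (𝓝 (fderiv ℝ (fderiv ℝ g) x₀)) := h.tendsto_prod_hessian.comp (tendsto_id.prodMk hx)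
  have hH' := ((tendsto_iff_norm_sub_tendsto_zero
    (E := V →L[ℝ] V →L[ℝ] ℝ)).1 hH).eventually_lt_const (half_pos hc)
  -- on a ball of this radius the cubic remainder is dominated by the quadratic term
  set δ : ℝ := min r (c / (16 * (C + 1)))
  have hδ : 0 < δ := lt_min h.pos (by positivity)
  refine ⟨c / 8, by positivity, δ, hδ, ?_⟩
  filter_upwards [hev, hH', hcrit, hx.eventually (Metric.ball_mem_nhds x₀ hδ)]
    with n hn hHn hcn hxn z hz
  have ht := hn.taylor (convex_ball _ _) hC (Metric.ball_subset_ball (min_le_left _ _) hxn)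
    (Metric.ball_subset_ball (min_le_left _ _) hz)
  set v := z - x n
  have hv : ‖v‖ ≤ c / (8 * (C + 1)) := by
    have h1 : ‖v‖ < δ + δ := by
      rw [← dist_eq_norm]
      exact (dist_triangle_right z (x n) x₀).trans_lt (add_lt_add hz hxn)
    have h2 : δ ≤ c / (16 * (C + 1)) := min_le_right _ _
    calc ‖v‖ ≤ c / (16 * (C + 1)) + c / (16 * (C + 1)) := by linarith
      _ = _ := by field_simp; norm_num
  have hcub : C * ‖v‖ ^ 3 ≤ c / 8 * ‖v‖ ^ 2 := by
    have : C * ‖v‖ ≤ c / 8 := by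
      calc C * ‖v‖ ≤ (C + 1) * (c / (8 * (C + 1))) := by gcongr; linarith
        _ = c / 8 := by field_simp
    calc C * ‖v‖ ^ 3 = C * ‖v‖ * ‖v‖ ^ 2 := by ring
      _ ≤ _ := by gcongr
  have hquad : fderiv ℝ (fderiv ℝ (f n)) (x n) v v ≤ -(c / 2) * ‖v‖ ^ 2 := by
    have h1 := hcoer v
    have h2 := (fderiv ℝ (fderiv ℝ (f n)) (x n) - fderiv ℝ (fderiv ℝ g) x₀).le_opNorm₂ v v
    have h3 := (le_abs_self _).trans h2
    simp only [sub_apply, neg_apply] at h1 h3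
    nlinarith [mul_le_mul_of_nonneg_right hHn.le (sq_nonneg ‖v‖)]
  have h4 := (le_abs_self _).trans ht
  rw [hcn] at h4
  simp only [zero_apply, sub_zero, smul_eq_mul] at h4
  linarith

/-- The second-order expansion at the critical points `x n`, on the scale `n^(-1/2)`. -/
theorem UniformlyC3.tendsto_mul_sub (h : UniformlyC3 f g x₀ r)
    (hx : Tendsto x atTop (𝓝 x₀)) (hcrit : ∀ᶠ n in atTop, fderiv ℝ (f n) (x n) = 0)
    {w : ℕ → V} {w₀ : V} (hw : Tendsto w atTop (𝓝 w₀)) :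
    Tendsto (fun n : ℕ => n * (f n (x n + (√(n : ℝ))⁻¹ • w n) - f n (x n))) atTop
      (𝓝 (fderiv ℝ (fderiv ℝ g) x₀ w₀ w₀ / 2)) := by
  obtain ⟨C, hC, hev⟩ := h.exists_hasLipschitzHessian
  have hH : Tendsto (fun n => fderiv ℝ (fderiv ℝ (f n)) (x n)) atTop
      (𝓝 (fderiv ℝ (fderiv ℝ g) x₀)) := h.tendsto_prod_hessian.comp (tendsto_id.prodMk hx)
  have hz : Tendsto (fun n => x n + (√(n : ℝ))⁻¹ • w n) atTop (𝓝 x₀) := by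
    simpa using hx.add (tendsto_inv_sqrt_natCast.smul hw)
  have hmain : Tendsto (fun n => fderiv ℝ (fderiv ℝ (f n)) (x n) (w n) (w n) / 2) atTop
      (𝓝 (fderiv ℝ (fderiv ℝ g) x₀ w₀ w₀ / 2)) := (tendsto_clm_apply (tendsto_clm_apply hH hw) hw).div_const 2
  have hrem : Tendsto (fun n : ℕ => (√(n : ℝ))⁻¹ * (C * ‖w n‖ ^ 3)) atTop (𝓝 0) := by
    simpa using tendsto_inv_sqrt_natCast.mul ((hw.norm.pow 3).const_mul C)
  have hdiff : Tendsto (fun n : ℕ => n * (f n (x n + (√(n : ℝ))⁻¹ • w n) - f n (x n))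
      - fderiv ℝ (fderiv ℝ (f n)) (x n) (w n) (w n) / 2) atTop (𝓝 0) := by
    refine squeeze_zero_norm' ?_ hrem
    filter_upwards [hev, hcrit, eventually_gt_atTop 0, hx.eventually (Metric.ball_mem_nhds x₀ h.pos),
      hz.eventually (Metric.ball_mem_nhds x₀ h.pos)] with n hn hcn hn0 h1 h2
    have h3 := hn.taylor (convex_ball _ _) hC h1 h2
    have hn0' : (0 : ℝ) < n := Nat.cast_pos.2 hn0
    have hs : 0 < √(n : ℝ) := Real.sqrt_pos.2 hn0'
    set t := (√(n : ℝ))⁻¹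
    have hnt : (n : ℝ) * t ^ 2 = 1 := by
      rw [inv_pow, Real.sq_sqrt hn0'.le, mul_inv_cancel₀ hn0'.ne']
    have ht0 : 0 < t := inv_pos.2 hs
    rw [add_sub_cancel_left, hcn, norm_smul, Real.norm_of_nonneg ht0.le] at h3
    simp only [zero_apply, mul_zero, sub_zero, smul_eq_mul, map_smul, smul_apply] at h3
    calc _ = ‖(n : ℝ) * (f n (x n + t • w n) - f n (x n)
          - 1 / 2 * (t * (t * fderiv ℝ (fderiv ℝ (f n)) (x n) (w n) (w n))))‖ := by
            congr 1
            linear_combination (1 / 2 * fderiv ℝ (fderiv ℝ (f n)) (x n) (w n) (w n)) * hnt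
      _ ≤ n * (C * (t * ‖w n‖) ^ 3) := by
            rw [norm_mul, Real.norm_of_nonneg hn0'.le]
            gcongr
      _ = t * (C * ‖w n‖ ^ 3) := by linear_combination t * (C * ‖w n‖ ^ 3) * hnt
  simpa using hdiff.add hmain

/-- The difference quotients of `f n` at `x n` on the scale `n^(-1/2)` converge to the derivative of
the limit. -/
theorem UniformlyC3.tendsto_sqrt_smul_sub {F : Type*} [NormedAddCommGroup F] [NormedSpace ℝ F]
    [CompleteSpace F] {f : ℕ → V → F} {g : V → F} (h : UniformlyC3 f g x₀ r)
    (hx : Tendsto x atTop (𝓝 x₀)) (u : V) :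
    Tendsto (fun n : ℕ => √(n : ℝ) • (f n (x n + (√(n : ℝ))⁻¹ • u) - f n (x n))) atTop
      (𝓝 (fderiv ℝ g x₀ u)) := by
  obtain ⟨C, hC, hev⟩ := h.exists_hasLipschitzHessian
  obtain ⟨B, hB, hBev⟩ := h.exists_lipschitz_fderiv
  have hz : Tendsto (fun n => x n + (√(n : ℝ))⁻¹ • u) atTop (𝓝 x₀) := by
    simpa using hx.add (tendsto_inv_sqrt_natCast.smul_const u)
  have hD : Tendsto (fun n => fderiv ℝ (f n) (x n)) atTop (𝓝 (fderiv ℝ g x₀)) :=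
    h.tendsto_prod_fderiv.comp (tendsto_id.prodMk hx)
  have hdiff : Tendsto (fun n : ℕ => √(n : ℝ) • (f n (x n + (√(n : ℝ))⁻¹ • u) - f n (x n))
      - fderiv ℝ (f n) (x n) u) atTop (𝓝 0) := by
    have hrem : Tendsto (fun n : ℕ => (√(n : ℝ))⁻¹ * (B * ‖u‖ ^ 2)) atTop (𝓝 0) := by
      simpa using tendsto_inv_sqrt_natCast.mul_const (B * ‖u‖ ^ 2)
    refine squeeze_zero_norm' ?_ hrem
    filter_upwards [hev, hBev, eventually_gt_atTop 0,
      hx.eventually (Metric.ball_mem_nhds x₀ h.pos),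
      hz.eventually (Metric.ball_mem_nhds x₀ h.pos)] with n hn hBn hn0 h1 h2
    have hs : 0 < √(n : ℝ) := Real.sqrt_pos.2 (Nat.cast_pos.2 hn0)
    have h3 := norm_sub_taylor_one_le (convex_ball x₀ r) hB hn.hasFDerivAt hBn h1 h2
    rw [add_sub_cancel_left, norm_smul, norm_inv, Real.norm_of_nonneg hs.le] at h3
    calc _ = ‖√(n : ℝ) • (f n (x n + (√(n : ℝ))⁻¹ • u) - f n (x n)
          - fderiv ℝ (f n) (x n) ((√(n : ℝ))⁻¹ • u))‖ := by
            rw [smul_sub _ _ (fderiv ℝ (f n) (x n) ((√(n : ℝ))⁻¹ • u)), map_smul,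
              smul_inv_smul₀ hs.ne']
      _ ≤ √(n : ℝ) * (B * ((√(n : ℝ))⁻¹ * ‖u‖) ^ 2) := by
            rw [norm_smul, Real.norm_of_nonneg hs.le]
            gcongr
      _ = _ := by field_simp
  simpa using hdiff.add (tendsto_clm_apply hD (tendsto_const_nhds (x := u)))

end Quadratic

/-- The law on `V` with density proportional to `exp (-Q / 2)`; for a positive definite quadratic
form `Q` this is the centered Gaussian law with precision `Q`. -/
noncomputable def gaussLaw {V : Type*} [MeasurableSpace V] (μ : Measure V) (Q : V → ℝ) : Measure V :=
  normalize (μ.withDensity fun u => ENNReal.ofReal (Real.exp (-Q u / 2)))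

section GaussLaw

variable {V : Type*} [NormedAddCommGroup V] [NormedSpace ℝ V] [FiniteDimensional ℝ V]
  [MeasurableSpace V] [BorelSpace V] {μ : Measure V} [μ.IsAddHaarMeasure]

theorem integrable_exp_neg_mul_sq_norm {c : ℝ} (hc : 0 < c) :
    Integrable (fun u : V => Real.exp (-(c * ‖u‖ ^ 2))) μ := by
  set m : ℕ := Module.finrank ℝ V + 1
  have h1 : Integrable (fun u : V => Real.exp ((m : ℝ) ^ 2 / (4 * c)) * (1 + ‖u‖) ^ (-(m : ℝ))) μ :=
    (integrable_one_add_norm (by simp [m])).const_mul _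
  refine h1.mono' (by fun_prop) (ae_of_all _ fun u => ?_)
  rw [Real.norm_of_nonneg (Real.exp_nonneg _), Real.rpow_neg (by positivity), Real.rpow_natCast,
    ← div_eq_mul_inv, le_div_iff₀ (by positivity)]
  have h2 : (1 + ‖u‖) ^ m ≤ Real.exp (m * ‖u‖) := by
    rw [Real.exp_nat_mul]
    gcongr
    linarith [Real.add_one_le_exp ‖u‖]
  calc Real.exp (-(c * ‖u‖ ^ 2)) * (1 + ‖u‖) ^ m
      ≤ Real.exp (-(c * ‖u‖ ^ 2)) * Real.exp (m * ‖u‖) := by gcongr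
    _ = Real.exp (-(c * ‖u‖ ^ 2) + m * ‖u‖) := (Real.exp_add _ _).symm
    _ ≤ _ := by
      gcongr
      rw [le_div_iff₀ (by positivity)]
      nlinarith [sq_nonneg (2 * c * ‖u‖ - m)]

variable {Q : V → ℝ}

theorem integrable_exp_neg_half (hQ : Continuous Q) (hc : ∃ c > 0, ∀ u, c * ‖u‖ ^ 2 ≤ Q u) :
    Integrable (fun u : V => Real.exp (-Q u / 2)) μ := by
  obtain ⟨c, hc, h⟩ := hc
  refine (integrable_exp_neg_mul_sq_norm (half_pos hc)).mono'
    (by fun_prop) (ae_of_all _ fun u => ?_)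
  rw [Real.norm_of_nonneg (Real.exp_nonneg _)]
  gcongr
  linarith [h u]

theorem integral_exp_neg_half_pos (hQ : Continuous Q) (hc : ∃ c > 0, ∀ u, c * ‖u‖ ^ 2 ≤ Q u) :
    0 < ∫ u, Real.exp (-Q u / 2) ∂μ :=
  integral_exp_pos (integrable_exp_neg_half hQ hc)

omit [NormedSpace ℝ V] [FiniteDimensional ℝ V] [μ.IsAddHaarMeasure] in
theorem integral_gaussLaw (hQ : Continuous Q) (ψ : V → ℝ) :
    ∫ u, ψ u ∂gaussLaw μ Q =
      (∫ u, ψ u * Real.exp (-Q u / 2) ∂μ) / ∫ u, Real.exp (-Q u / 2) ∂μ := by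
  have hm : Measurable fun u => ENNReal.ofReal (Real.exp (-Q u / 2)) := by fun_prop
  rw [gaussLaw, normalize, integral_smul_measure,
    integral_withDensity_eq_integral_toReal_smul hm (ae_of_all _ fun _ => ENNReal.ofReal_lt_top),
    withDensity_apply _ MeasurableSet.univ, Measure.restrict_univ, ENNReal.toReal_inv,
    integral_eq_lintegral_of_nonneg_ae (f := fun u => Real.exp (-Q u / 2))
      (ae_of_all _ fun _ => Real.exp_nonneg _) (by fun_prop), smul_eq_mul, div_eq_inv_mul]
  simp only [ENNReal.toReal_ofReal (Real.exp_nonneg _), smul_eq_mul, mul_comm]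

theorem withDensity_gauss_univ (hQ : Continuous Q) (hc : ∃ c > 0, ∀ u, c * ‖u‖ ^ 2 ≤ Q u) :
    (μ.withDensity fun u => ENNReal.ofReal (Real.exp (-Q u / 2))) Set.univ =
      ENNReal.ofReal (∫ u, Real.exp (-Q u / 2) ∂μ) := by
  rw [withDensity_apply _ MeasurableSet.univ, Measure.restrict_univ,
    ofReal_integral_eq_lintegral_ofReal (integrable_exp_neg_half hQ hc)
      (ae_of_all _ fun _ => Real.exp_nonneg _)]

theorem isProbabilityMeasure_gaussLaw (hQ : Continuous Q)
    (hc : ∃ c > 0, ∀ u, c * ‖u‖ ^ 2 ≤ Q u) : IsProbabilityMeasure (gaussLaw μ Q) := by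
  refine ⟨?_⟩
  rw [gaussLaw, normalize, Measure.smul_apply, smul_eq_mul, withDensity_gauss_univ hQ hc]
  exact ENNReal.inv_mul_cancel
    (ENNReal.ofReal_pos.2 (integral_exp_neg_half_pos hQ hc)).ne' ENNReal.ofReal_ne_top

theorem memLp_two_gaussLaw (hQ : Continuous Q) (hc : ∃ c > 0, ∀ u, c * ‖u‖ ^ 2 ≤ Q u)
    (l : V →L[ℝ] ℝ) : MemLp (fun u => l u) 2 (gaussLaw μ Q) := by
  rw [memLp_two_iff_integrable_sq (by fun_prop)]
  have hZ := integral_exp_neg_half_pos (μ := μ) hQ hc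
  obtain ⟨c, hc0, h⟩ := id hc
  rw [gaussLaw, normalize]
  refine Integrable.smul_measure ?_ (ENNReal.inv_ne_top.2 ?_)
  · rw [integrable_withDensity_iff_integrable_smul' (by fun_prop)
      (ae_of_all _ fun _ => ENNReal.ofReal_lt_top)]
    refine ((integrable_exp_neg_mul_sq_norm (μ := μ) (half_pos (half_pos hc0))).const_mul
      (‖l‖ ^ 2 * (4 / c))).mono' (by
        simp only [ENNReal.toReal_ofReal (Real.exp_nonneg _)]; fun_prop) (ae_of_all _ fun u => ?_)
    rw [ENNReal.toReal_ofReal (Real.exp_nonneg _), smul_eq_mul, norm_mul, norm_pow,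
      Real.norm_of_nonneg (Real.exp_nonneg _)]
    have h1 : ‖l u‖ ^ 2 ≤ (‖l‖ * ‖u‖) ^ 2 := by gcongr; exact l.le_opNorm u
    -- `t ≤ exp t` absorbs the factor `‖u‖²` into half of the exponent
    have h2 : c / 4 * ‖u‖ ^ 2 ≤ Real.exp (c / 4 * ‖u‖ ^ 2) := by
      linarith [Real.add_one_le_exp (c / 4 * ‖u‖ ^ 2)]
    have h3 : ‖u‖ ^ 2 ≤ 4 / c * Real.exp (c / 4 * ‖u‖ ^ 2) := by
      rw [div_mul_eq_mul_div, le_div_iff₀ hc0]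
      linarith
    calc Real.exp (-Q u / 2) * ‖l u‖ ^ 2
        ≤ Real.exp (-(c / 2 * ‖u‖ ^ 2)) * (‖l‖ ^ 2 * (4 / c * Real.exp (c / 4 * ‖u‖ ^ 2))) := by
          gcongr
          · linarith [h u]
          · exact h1.trans (by rw [mul_pow]; gcongr)
      _ = ‖l‖ ^ 2 * (4 / c) *
          (Real.exp (-(c / 2 * ‖u‖ ^ 2)) * Real.exp (c / 4 * ‖u‖ ^ 2)) := by ring
      _ = _ := by
          rw [← Real.exp_add]
          congr 2
          ring
  · rw [withDensity_gauss_univ hQ hc]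
    exact (ENNReal.ofReal_pos.2 hZ).ne'

theorem absolutelyContinuous_gaussLaw (hQ : Continuous Q) (hc : ∃ c > 0, ∀ u, c * ‖u‖ ^ 2 ≤ Q u) :
    μ ≪ gaussLaw μ Q := by
  have h1 : μ ≪ μ.withDensity fun u => ENNReal.ofReal (Real.exp (-Q u / 2)) :=
    withDensity_absolutelyContinuous' (by fun_prop)
      (ae_of_all _ fun u => (ENNReal.ofReal_pos.2 (Real.exp_pos _)).ne')
  refine h1.trans (Measure.AbsolutelyContinuous.rfl.smul_right ?_)
  rw [withDensity_gauss_univ hQ hc]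
  exact ENNReal.inv_ne_zero.2 ENNReal.ofReal_ne_top

theorem variance_gaussLaw_pos (hQ : Continuous Q) (hc : ∃ c > 0, ∀ u, c * ‖u‖ ^ 2 ≤ Q u)
    {l : V →L[ℝ] ℝ} (hl : l ≠ 0) : 0 < variance (fun u => l u) (gaussLaw μ Q) := by
  have := isProbabilityMeasure_gaussLaw (μ := μ) hQ hc
  refine lt_of_le_of_ne (variance_nonneg _ _) fun h0 => ?_
  have hL := memLp_two_gaussLaw (μ := μ) hQ hc l
  have h1 : evariance (fun u => l u) (gaussLaw μ Q) = 0 := by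
    rw [← hL.ofReal_variance_eq, ← h0, ENNReal.ofReal_zero]
  rw [evariance_eq_zero_iff hL.aestronglyMeasurable.aemeasurable] at h1
  set m := ∫ u, l u ∂gaussLaw μ Q
  have h2 : ∀ᵐ u ∂μ, l u = m := (absolutelyContinuous_gaussLaw hQ hc).ae_le h1
  have h3 : (fun u => l u) = fun _ => m :=
    Measure.eq_of_ae_eq h2 l.continuous continuous_const
  refine hl (ContinuousLinearMap.ext fun u => ?_)
  have h4 := congrFun h3 u
  have h5 := congrFun h3 0
  simp only [map_zero] at h4 h5
  simp [h4, ← h5]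

theorem gaussLaw_prod {W : Type*} [NormedAddCommGroup W] [NormedSpace ℝ W] [FiniteDimensional ℝ W]
    [MeasurableSpace W] [BorelSpace W] {ν : Measure W} [ν.IsAddHaarMeasure] {R : W → ℝ}
    (hQ : Continuous Q) (hc : ∃ c > 0, ∀ u, c * ‖u‖ ^ 2 ≤ Q u)
    (hR : Continuous R) (hd : ∃ c > 0, ∀ u, c * ‖u‖ ^ 2 ≤ R u) :
    (gaussLaw μ Q).prod (gaussLaw ν R) = gaussLaw (μ.prod ν) (fun x => Q x.1 + R x.2) := by
  have hdens : (μ.prod ν).withDensity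
      (fun x => ENNReal.ofReal (Real.exp (-(Q x.1 + R x.2) / 2))) =
      (μ.withDensity fun u => ENNReal.ofReal (Real.exp (-Q u / 2))).prod
        (ν.withDensity fun u => ENNReal.ofReal (Real.exp (-R u / 2))) := by
    rw [prod_withDensity (by fun_prop) (by fun_prop)]
    congr 1
    ext x
    rw [← ENNReal.ofReal_mul (Real.exp_nonneg _), ← Real.exp_add]
    congr 2
    ring
  have h1 := withDensity_gauss_univ (μ := μ) hQ hc
  have h2 := withDensity_gauss_univ (μ := ν) hR hd
  rw [gaussLaw, gaussLaw, gaussLaw, hdens, normalize, normalize, normalize,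
    Measure.prod_smul_left, Measure.prod_smul_right, smul_smul,
    ← Set.univ_prod_univ (α := V) (β := W), Measure.prod_prod, ENNReal.mul_inv (Or.inr (by simp [h2]))
      (Or.inl (by simp [h1]))]

end GaussLaw

end Bridged

/-! ### Laplace's method -/

namespace Bridged

/-- The unnormalized posterior on `S` with prior density `ρ` and likelihood `Λ n`. -/
noncomputable def posteriorMeasure {V : Type*} [MeasurableSpace V] (μ : Measure V) (S : Set V)
    (ρ : V → ℝ) (Λ : ℕ → V → ℝ) (n : ℕ) : Measure V :=
  (μ.restrict S).withDensity fun z => ENNReal.ofReal (ρ z * Λ n z)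

/-- The factor by which the unnormalized posterior of a sample of size `n` is multiplied in order to
converge, when its mass sits at distance `O(n^(-1/2))` from `x n`. -/
noncomputable def laplaceScale {V : Type*} [NormedAddCommGroup V] [NormedSpace ℝ V]
    (F : ℕ → V → ℝ) (x : ℕ → V) (n : ℕ) : ℝ :=
  √(n : ℝ) ^ Module.finrank ℝ V * Real.exp (-(n * F n (x n)))

/-- The setting of Laplace's method: the likelihoods are `Λ n = exp (n F n)` on `S`, and near `x₀`
the average log-likelihoods `F n` have nondegenerate maxima at `x n → x₀`, with limiting second-order
behaviour `-Q / 2` and limiting value `c₀`. -/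
structure LaplaceFamily {V : Type*} [NormedAddCommGroup V] [NormedSpace ℝ V] [MeasurableSpace V]
    (μ : Measure V) (S : Set V) (ρ : V → ℝ) (Λ F : ℕ → V → ℝ) (x : ℕ → V) (x₀ : V) (c₀ : ℝ)
    (Q : V → ℝ) : Prop where
  measurableSet : MeasurableSet S
  mem_nhds : S ∈ 𝓝 x₀
  prior_nonneg : ∀ z, 0 ≤ ρ z
  prior_measurable : Measurable ρ
  prior_continuousAt : ContinuousAt ρ x₀
  prior_pos : 0 < ρ x₀
  likelihood_aemeasurable : ∀ᶠ n in atTop, AEMeasurable (Λ n) (μ.restrict S)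
  likelihood_eq : ∀ᶠ n in atTop, ∀ z ∈ S, Λ n z = Real.exp (n * F n z)
  tendsto_center : Tendsto x atTop (𝓝 x₀)
  tendsto_value : Tendsto (fun n => F n (x n)) atTop (𝓝 c₀)
  sub_le : ∃ c > 0, ∃ δ > 0, ∀ᶠ n in atTop, ∀ z ∈ Metric.ball x₀ δ,
    F n z - F n (x n) ≤ -(c * ‖z - x n‖ ^ 2)
  tendsto_mul_sub : ∀ u, Tendsto (fun n : ℕ => n * (F n (x n + (√(n : ℝ))⁻¹ • u) - F n (x n))) atTop
    (𝓝 (-Q u / 2))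
  form_continuous : Continuous Q
  form_coercive : ∃ c > 0, ∀ u, c * ‖u‖ ^ 2 ≤ Q u

namespace LaplaceFamily

variable {V : Type*} [NormedAddCommGroup V] [NormedSpace ℝ V] [FiniteDimensional ℝ V]
  [MeasurableSpace V] [BorelSpace V] {μ : Measure V} [μ.IsAddHaarMeasure] {S : Set V} {ρ : V → ℝ}
  {Λ F : ℕ → V → ℝ} {x : ℕ → V} {x₀ : V} {c₀ : ℝ} {Q : V → ℝ}

/-- Laplace's method on a fixed small ball: after the substitution `z = x n + u / √n` the integrands
converge, and they are dominated by a Gaussian. -/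
theorem tendsto_setIntegral (h : LaplaceFamily μ S ρ Λ F x x₀ c₀ Q) :
    ∃ δ₀ > 0, ∀ δ, 0 < δ → δ ≤ δ₀ → Metric.ball x₀ δ ⊆ S ∧
      (∀ᶠ n in atTop, posteriorMeasure μ S ρ Λ n (Metric.ball x₀ δ) < ⊤) ∧
      ∀ (ψ : ℕ → V → ℝ) (Ψ : V → ℝ) (M : ℝ),
        (∀ᶠ n in atTop, AEStronglyMeasurable (ψ n) (μ.restrict S)) → (∀ n z, |ψ n z| ≤ M) →
        (∀ u, Tendsto (fun n => ψ n (x n + (√(n : ℝ))⁻¹ • u)) atTop (𝓝 (Ψ u))) →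
        Tendsto (fun n => laplaceScale F x n *
            ∫ z in Metric.ball x₀ δ, ψ n z ∂posteriorMeasure μ S ρ Λ n) atTop
          (𝓝 (ρ x₀ * ∫ u, Ψ u * Real.exp (-Q u / 2) ∂μ)) := by
  obtain ⟨c, hc, δ₁, hδ₁, hquad⟩ := h.sub_le
  obtain ⟨δ₂, hδ₂, hS⟩ := Metric.mem_nhds_iff.1 h.mem_nhds
  obtain ⟨δ₃, hδ₃, hρ⟩ := Metric.eventually_nhds_iff_ball.1
    (h.prior_continuousAt.eventually_lt_const (lt_add_one (ρ x₀)))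
  refine ⟨min δ₁ (min δ₂ δ₃), by positivity, fun δ hδ hδle => ?_⟩
  have hb₁ : Metric.ball x₀ δ ⊆ Metric.ball x₀ δ₁ :=
    Metric.ball_subset_ball (hδle.trans (min_le_left _ _))
  have hbS : Metric.ball x₀ δ ⊆ S := (Metric.ball_subset_ball
    (hδle.trans ((min_le_right _ _).trans (min_le_left _ _)))).trans hS
  have hbρ : ∀ z ∈ Metric.ball x₀ δ, ρ z ≤ ρ x₀ + 1 := fun z hz => (hρ z (Metric.ball_subset_ball
    (hδle.trans ((min_le_right _ _).trans (min_le_right _ _))) hz)).le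
  have hmeas : MeasurableSet (Metric.ball x₀ δ) := Metric.isOpen_ball.measurableSet
  have hrestr : ∀ n, (posteriorMeasure μ S ρ Λ n).restrict (Metric.ball x₀ δ) =
      (μ.restrict (Metric.ball x₀ δ)).withDensity fun z => ENNReal.ofReal (ρ z * Λ n z) := by
    intro n
    rw [posteriorMeasure, restrict_withDensity hmeas, Measure.restrict_restrict hmeas,
      Set.inter_eq_left.2 hbS]
  refine ⟨hbS, ?_, fun ψ Ψ M hψm hψM hψ => ?_⟩
  · filter_upwards [h.likelihood_eq, hquad] with n hn hq
    rw [posteriorMeasure, withDensity_apply _ hmeas, Measure.restrict_restrict hmeas,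
      Set.inter_eq_left.2 hbS]
    refine setLIntegral_lt_top_of_le_nnreal measure_ball_lt_top.ne
      ⟨((ρ x₀ + 1) * Real.exp (n * F n (x n))).toNNReal, fun z hz => ?_⟩
    refine ENNReal.ofReal_le_ofReal ?_
    rw [hn z (hbS hz)]
    refine mul_le_mul (hbρ z hz) ?_ (Real.exp_nonneg _) (by linarith [h.prior_pos])
    have := hq z (hb₁ hz)
    gcongr
    nlinarith [sq_nonneg ‖z - x n‖]
  have hM : 0 ≤ M := (abs_nonneg _).trans (hψM 0 x₀)
  -- the integrand after the substitution
  let G : ℕ → V → ℝ := fun n z => (Metric.ball x₀ δ).indicator (fun z => ψ n z * (ρ z * Λ n z)) z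
  have hsubst : ∀ᶠ n : ℕ in atTop, laplaceScale F x n *
      ∫ z in Metric.ball x₀ δ, ψ n z ∂posteriorMeasure μ S ρ Λ n =
      ∫ u, Real.exp (-(n * F n (x n))) * G n (x n + (√(n : ℝ))⁻¹ • u) ∂μ := by
    filter_upwards [h.likelihood_aemeasurable, h.likelihood_eq, eventually_gt_atTop 0]
      with n hn hΛ hn0
    have hs : 0 < √(n : ℝ) := Real.sqrt_pos.2 (Nat.cast_pos.2 hn0)
    have h1 : ∫ z in Metric.ball x₀ δ, ψ n z ∂posteriorMeasure μ S ρ Λ n = ∫ z, G n z ∂μ := by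
      rw [hrestr, integral_withDensity_eq_integral_toReal_smul₀
        (AEMeasurable.ennreal_ofReal (f := fun z => ρ z * Λ n z)
          (h.prior_measurable.aemeasurable.mul (hn.mono_set hbS)))
        (ae_of_all _ fun _ => ENNReal.ofReal_lt_top), integral_indicator hmeas]
      refine setIntegral_congr_fun hmeas fun z hz => ?_
      rw [ENNReal.toReal_ofReal, smul_eq_mul, mul_comm]
      rw [hΛ z (hbS hz)]
      exact mul_nonneg (h.prior_nonneg z) (Real.exp_nonneg _)
    have h2 := Measure.integral_comp_smul μ (fun y => G n (x n + y)) (√(n : ℝ))⁻¹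
    rw [integral_add_left_eq_self (fun y => G n y) (x n), inv_pow, inv_inv,
      abs_of_nonneg (by positivity), smul_eq_mul] at h2
    rw [integral_const_mul, h2, h1, laplaceScale]
    ring
  refine Tendsto.congr' (hsubst.mono fun n hn => hn.symm) ?_
  rw [← integral_const_mul]
  refine tendsto_integral_filter_of_dominated_convergence
    (fun u => M * (ρ x₀ + 1) * Real.exp (-(c * ‖u‖ ^ 2))) ?_ ?_
    ((integrable_exp_neg_mul_sq_norm hc).const_mul _) (ae_of_all _ fun u => ?_)
  · filter_upwards [h.likelihood_aemeasurable, hψm, eventually_gt_atTop 0] with n hn hψn hn0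
    have hs : (√(n : ℝ))⁻¹ ≠ 0 := (inv_pos.2 (Real.sqrt_pos.2 (Nat.cast_pos.2 hn0))).ne'
    have hG : AEStronglyMeasurable (G n) μ := (aestronglyMeasurable_indicator_iff hmeas).2
      ((hψn.mono_set hbS).mul
        (h.prior_measurable.aemeasurable.mul (hn.mono_set hbS)).aestronglyMeasurable)
    exact (hG.comp_quasiMeasurePreserving ((quasiMeasurePreserving_add_left μ (x n)).comp
      (Measure.quasiMeasurePreserving_smul μ hs))).const_mul _
  · filter_upwards [h.likelihood_eq, hquad, eventually_gt_atTop 0] with n hΛ hq hn0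
    refine ae_of_all _ fun u => ?_
    have hn0' : (0 : ℝ) < n := Nat.cast_pos.2 hn0
    by_cases hz : x n + (√(n : ℝ))⁻¹ • u ∈ Metric.ball x₀ δ
    · have h1 := hq _ (hb₁ hz)
      rw [add_sub_cancel_left, norm_smul, norm_inv, Real.norm_of_nonneg (Real.sqrt_nonneg _),
        mul_pow, inv_pow, Real.sq_sqrt hn0'.le] at h1
      simp only [G, Set.indicator_of_mem hz, hΛ _ (hbS hz)]
      set z := x n + (√(n : ℝ))⁻¹ • u
      have h2 : n * F n z - n * F n (x n) ≤ -(c * ‖u‖ ^ 2) := by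
        calc n * F n z - n * F n (x n) = n * (F n z - F n (x n)) := by ring
          _ ≤ n * -(c * ((n : ℝ)⁻¹ * ‖u‖ ^ 2)) := by gcongr
          _ = _ := by field_simp
      calc _ = |ψ n z| * ρ z * (Real.exp (n * F n z) * Real.exp (-(n * F n (x n)))) := by
            rw [Real.norm_eq_abs, abs_mul, abs_mul, abs_mul, abs_of_nonneg (Real.exp_nonneg _),
              abs_of_nonneg (Real.exp_nonneg _), abs_of_nonneg (h.prior_nonneg z)]
            ring
        _ ≤ M * (ρ x₀ + 1) * Real.exp (-(c * ‖u‖ ^ 2)) := by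
            rw [← Real.exp_add]
            have h3 : |ψ n z| * ρ z ≤ M * (ρ x₀ + 1) :=
              mul_le_mul (hψM n z) (hbρ z hz) (h.prior_nonneg z) hM
            refine mul_le_mul h3 (Real.exp_le_exp.2 (by linarith)) (Real.exp_nonneg _)
              (mul_nonneg hM (by linarith [h.prior_pos]))
    · simp only [G, Set.indicator_of_notMem hz, mul_zero, norm_zero]
      have := h.prior_pos
      positivity
  · have hz : Tendsto (fun n => x n + (√(n : ℝ))⁻¹ • u) atTop (𝓝 x₀) := by
      simpa using h.tendsto_center.add (tendsto_inv_sqrt_natCast.smul_const u)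
    have h1 : Tendsto (fun n : ℕ => ψ n (x n + (√(n : ℝ))⁻¹ • u) * ρ (x n + (√(n : ℝ))⁻¹ • u) *
        Real.exp (n * (F n (x n + (√(n : ℝ))⁻¹ • u) - F n (x n)))) atTop
        (𝓝 (Ψ u * ρ x₀ * Real.exp (-Q u / 2))) :=
      ((hψ u).mul (h.prior_continuousAt.tendsto.comp hz)).mul
        ((Real.continuous_exp.tendsto _).comp (h.tendsto_mul_sub u))
    rw [show ρ x₀ * (Ψ u * Real.exp (-Q u / 2)) = Ψ u * ρ x₀ * Real.exp (-Q u / 2) by ring]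
    refine h1.congr' ?_
    filter_upwards [h.likelihood_eq, hz.eventually (Metric.ball_mem_nhds x₀ hδ)] with n hΛ hzn
    simp only [G, Set.indicator_of_mem (show _ ∈ Metric.ball x₀ δ from hzn), hΛ _ (hbS hzn)]
    rw [mul_sub, sub_eq_add_neg, Real.exp_add]
    ring

omit [FiniteDimensional ℝ V] [MeasurableSpace V] [BorelSpace V] in
theorem laplaceScale_nonneg (n : ℕ) : 0 ≤ laplaceScale F x n := by
  unfold laplaceScale
  positivity

theorem tendsto_laplaceScale_mul_real_ball (h : LaplaceFamily μ S ρ Λ F x x₀ c₀ Q) :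
    ∃ δ₀ > 0, ∀ δ, 0 < δ → δ ≤ δ₀ →
      (∀ᶠ n in atTop, posteriorMeasure μ S ρ Λ n (Metric.ball x₀ δ) < ⊤) ∧
      Tendsto (fun n => laplaceScale F x n * (posteriorMeasure μ S ρ Λ n).real (Metric.ball x₀ δ))
        atTop (𝓝 (ρ x₀ * ∫ u, Real.exp (-Q u / 2) ∂μ)) := by
  obtain ⟨δ₀, hδ₀, hloc⟩ := h.tendsto_setIntegral
  refine ⟨δ₀, hδ₀, fun δ hδ hle => ⟨(hloc δ hδ hle).2.1, ?_⟩⟩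
  simpa using (hloc δ hδ hle).2.2 (fun _ _ => 1) (fun _ => 1) 1
    (Eventually.of_forall fun _ => aestronglyMeasurable_const) (by simp)
    (fun _ => tendsto_const_nhds)

/-- If the mass away from `x₀` is negligible on the scale of Laplace's method, then the posterior,
rescaled around `x n`, converges to `gaussLaw μ Q`. -/
theorem tendsto_integral_normalize (h : LaplaceFamily μ S ρ Λ F x x₀ c₀ Q)
    (hfar : ∀ δ > 0, Tendsto (fun n => ENNReal.ofReal (laplaceScale F x n) *
      posteriorMeasure μ S ρ Λ n (Metric.ball x₀ δ)ᶜ) atTop (𝓝 0))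
    {ψ : ℕ → V → ℝ} {Ψ : V → ℝ} {M : ℝ}
    (hψm : ∀ᶠ n in atTop, AEStronglyMeasurable (ψ n) (μ.restrict S)) (hψM : ∀ n z, |ψ n z| ≤ M)
    (hψ : ∀ u, Tendsto (fun n => ψ n (x n + (√(n : ℝ))⁻¹ • u)) atTop (𝓝 (Ψ u))) :
    (∀ᶠ n in atTop, posteriorMeasure μ S ρ Λ n Set.univ ≠ 0 ∧
      posteriorMeasure μ S ρ Λ n Set.univ ≠ ⊤) ∧
    Tendsto (fun n => ∫ z, ψ n z ∂normalize (posteriorMeasure μ S ρ Λ n)) atTop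
      (𝓝 (∫ u, Ψ u ∂gaussLaw μ Q)) := by
  obtain ⟨δ, hδ, hloc⟩ := h.tendsto_setIntegral
  obtain ⟨hbS, hfin, hlim⟩ := hloc δ hδ le_rfl
  have hmeas : MeasurableSet (Metric.ball x₀ δ) := Metric.isOpen_ball.measurableSet
  set m := posteriorMeasure μ S ρ Λ
  set a := laplaceScale F x
  have ha : ∀ n, 0 ≤ a n := laplaceScale_nonneg
  have ha' : ∀ᶠ n in atTop, 0 < a n := by
    filter_upwards [eventually_gt_atTop 0] with n hn
    have : 0 < √(n : ℝ) := Real.sqrt_pos.2 (Nat.cast_pos.2 hn)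
    exact mul_pos (by positivity) (Real.exp_pos _)
  have hfinc : ∀ᶠ n in atTop, m n (Metric.ball x₀ δ)ᶜ < ⊤ := by
    filter_upwards [(hfar δ hδ).eventually_lt_const (by simp : (0 : ENNReal) < 1), ha'] with n hn hpos
    by_contra htop
    rw [not_lt, top_le_iff] at htop
    rw [htop, ENNReal.mul_top (ENNReal.ofReal_pos.2 hpos).ne'] at hn
    exact not_top_lt hn
  have hfin' : ∀ᶠ n in atTop, IsFiniteMeasure (m n) := by
    filter_upwards [hfin, hfinc] with n h1 h2
    refine ⟨?_⟩
    rw [← measure_add_measure_compl hmeas]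
    exact ENNReal.add_lt_top.2 ⟨h1, h2⟩
  have hfar' : Tendsto (fun n => a n * (m n).real (Metric.ball x₀ δ)ᶜ) atTop (𝓝 0) := by
    have := (ENNReal.tendsto_toReal ENNReal.zero_ne_top).comp (hfar δ hδ)
    refine this.congr fun n => ?_
    simp [ENNReal.toReal_mul, ENNReal.toReal_ofReal (ha n), Measure.real]
  have key : ∀ (ψ : ℕ → V → ℝ) (Ψ : V → ℝ) (M : ℝ),
      (∀ᶠ n in atTop, AEStronglyMeasurable (ψ n) (μ.restrict S)) → (∀ n z, |ψ n z| ≤ M) →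
      (∀ u, Tendsto (fun n => ψ n (x n + (√(n : ℝ))⁻¹ • u)) atTop (𝓝 (Ψ u))) →
      Tendsto (fun n => a n * ∫ z, ψ n z ∂m n) atTop
          (𝓝 (ρ x₀ * ∫ u, Ψ u * Real.exp (-Q u / 2) ∂μ)) := by
    intro ψ Ψ M hψm hψM hψ
    have h1 := hlim ψ Ψ M hψm hψM hψ
    have h2 : Tendsto (fun n => a n * ∫ z in (Metric.ball x₀ δ)ᶜ, ψ n z ∂m n) atTop (𝓝 0) := by
      refine squeeze_zero_norm' ?_ (by simpa using hfar'.const_mul M)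
      filter_upwards [hfinc] with n htop
      rw [norm_mul, Real.norm_of_nonneg (ha n), mul_left_comm]
      refine mul_le_mul_of_nonneg_left ?_ (ha n)
      exact norm_setIntegral_le_of_norm_le_const htop fun z _ => hψM n z
    have h3 := h1.add h2
    rw [add_zero] at h3
    refine h3.congr' ?_
    filter_upwards [hfin', hψm] with n hn hψn
    have hint : Integrable (ψ n) (m n) :=
      Integrable.of_bound (hψn.mono_ac (withDensity_absolutelyContinuous _ _)) M
        (ae_of_all _ fun z => hψM n z)
    rw [← mul_add, integral_add_compl hmeas hint]
  have hone : Tendsto (fun n => a n * (m n).real Set.univ) atTop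
      (𝓝 (ρ x₀ * ∫ u, Real.exp (-Q u / 2) ∂μ)) := by
    simpa using key (fun _ _ => 1) (fun _ => 1) 1
      (Eventually.of_forall fun _ => aestronglyMeasurable_const) (by simp)
      (fun _ => tendsto_const_nhds)
  have hZ := integral_exp_neg_half_pos (μ := μ) h.form_continuous h.form_coercive
  have hZ' := mul_pos h.prior_pos hZ
  refine ⟨?_, ?_⟩
  · filter_upwards [hfin', hone.eventually_const_lt hZ'] with n hn hpos
    refine ⟨fun h0 => ?_, measure_ne_top _ _⟩
    simp [Measure.real, h0] at hpos
  · have h4 := (key ψ Ψ M hψm hψM hψ).div hone hZ'.ne'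
    rw [mul_div_mul_left _ _ h.prior_pos.ne', ← integral_gaussLaw h.form_continuous] at h4
    refine h4.congr' ?_
    filter_upwards [ha'] with n hpos
    rw [normalize, integral_smul_measure, ENNReal.toReal_inv, Pi.div_apply,
      mul_div_mul_left _ _ hpos.ne', smul_eq_mul, div_eq_inv_mul]
    rfl

omit [FiniteDimensional ℝ V] [BorelSpace V] [μ.IsAddHaarMeasure] in
/-- A region of finite prior mass on which the average log-likelihood stays below `c₀` is
negligible: its posterior mass is exponentially small. -/
theorem tendsto_mul_of_le (h : LaplaceFamily μ S ρ Λ F x x₀ c₀ Q) {B : Set V}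
    (hB : MeasurableSet B) (hρ : ∫⁻ z in S ∩ B, ENNReal.ofReal (ρ z) ∂μ < ⊤) {c : ℝ} (hc : c < c₀)
    (hF : ∀ᶠ n in atTop, ∀ z ∈ S ∩ B, F n z ≤ c) :
    Tendsto (fun n => ENNReal.ofReal (laplaceScale F x n) * posteriorMeasure μ S ρ Λ n B) atTop
      (𝓝 0) := by
  set η := (c₀ - c) / 2
  have hη : 0 < η := half_pos (sub_pos.2 hc)
  have hlim : Tendsto (fun n : ℕ => ENNReal.ofReal ((n : ℝ) ^ (Module.finrank ℝ V : ℝ) * Real.exp (-η * n)) *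
      ∫⁻ z in S ∩ B, ENNReal.ofReal (ρ z) ∂μ) atTop (𝓝 0) := by
    have h1 := (tendsto_rpow_mul_exp_neg_mul_atTop_nhds_zero (Module.finrank ℝ V) η hη).comp
      (tendsto_natCast_atTop_atTop (R := ℝ))
    have h2 := ENNReal.Tendsto.mul_const (b := ∫⁻ z in S ∩ B, ENNReal.ofReal (ρ z) ∂μ)
      (ENNReal.tendsto_ofReal h1) (Or.inr hρ.ne)
    simpa using h2
  refine tendsto_of_tendsto_of_tendsto_of_le_of_le' tendsto_const_nhds hlim
    (Eventually.of_forall fun _ => zero_le) ?_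
  filter_upwards [hF, h.likelihood_eq, eventually_gt_atTop 0,
    h.tendsto_value.eventually_const_lt (by simp only [η]; linarith : c + η < c₀)]
    with n hFn hΛ hn0 hval
  have hn1 : (1 : ℝ) ≤ n := Nat.one_le_cast.2 hn0
  have hmass : posteriorMeasure μ S ρ Λ n B ≤
      ENNReal.ofReal (Real.exp (n * c)) * ∫⁻ z in S ∩ B, ENNReal.ofReal (ρ z) ∂μ := by
    rw [posteriorMeasure, withDensity_apply _ hB, Measure.restrict_restrict hB, Set.inter_comm,
      ← lintegral_const_mul _ (by have := h.prior_measurable; fun_prop)]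
    refine setLIntegral_mono' (h.measurableSet.inter hB) fun z hz => ?_
    rw [hΛ z hz.1, mul_comm (ρ z), ENNReal.ofReal_mul (Real.exp_nonneg _)]
    gcongr
    exact hFn z hz
  calc _ ≤ ENNReal.ofReal (laplaceScale F x n) * (ENNReal.ofReal (Real.exp (n * c)) *
        ∫⁻ z in S ∩ B, ENNReal.ofReal (ρ z) ∂μ) := by gcongr
    _ = ENNReal.ofReal (laplaceScale F x n * Real.exp (n * c)) *
        ∫⁻ z in S ∩ B, ENNReal.ofReal (ρ z) ∂μ := by
      rw [← mul_assoc, ENNReal.ofReal_mul (laplaceScale_nonneg n)]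
    _ ≤ _ := by
      refine mul_le_mul_left (ENNReal.ofReal_le_ofReal ?_) _
      rw [laplaceScale, mul_assoc, ← Real.exp_add, Real.rpow_natCast]
      gcongr
      · rw [Real.sqrt_le_left (by positivity)]
        nlinarith
      · nlinarith

/-- If the posterior probability of the sets `B n` tends to zero, and these sets cover the
complement of a small ball up to a negligible set, then this complement is itself negligible. -/
theorem tendsto_far_of_tendsto_normalize (h : LaplaceFamily μ S ρ Λ F x x₀ c₀ Q)
    (hfin : ∀ᶠ n in atTop, posteriorMeasure μ S ρ Λ n Set.univ ≠ 0 ∧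
      posteriorMeasure μ S ρ Λ n Set.univ ≠ ⊤)
    (hcover : ∀ δ > 0, ∃ B B' : Set V, (Metric.ball x₀ δ)ᶜ ⊆ B ∪ B' ∧
      Tendsto (fun n => normalize (posteriorMeasure μ S ρ Λ n) B) atTop (𝓝 0) ∧
      Tendsto (fun n => ENNReal.ofReal (laplaceScale F x n) * posteriorMeasure μ S ρ Λ n B') atTop
        (𝓝 0)) (δ : ℝ) (hδ : 0 < δ) :
    Tendsto (fun n => ENNReal.ofReal (laplaceScale F x n) *
      posteriorMeasure μ S ρ Λ n (Metric.ball x₀ δ)ᶜ) atTop (𝓝 0) := by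
  obtain ⟨δ₀, hδ₀, hloc⟩ := h.tendsto_laplaceScale_mul_real_ball
  obtain ⟨hlocfin, hloclim⟩ := hloc (min δ δ₀) (lt_min hδ hδ₀) (min_le_right _ _)
  obtain ⟨B, B', hBB', hB, hB'⟩ := hcover (min δ δ₀) (lt_min hδ hδ₀)
  set m := posteriorMeasure μ S ρ Λ
  set a := fun n => ENNReal.ofReal (laplaceScale F x n)
  set Z := ρ x₀ * ∫ u, Real.exp (-Q u / 2) ∂μ
  set K : ENNReal := ENNReal.ofReal (Z + 1) + 1
  have hK : 2 * K ≠ ⊤ := by simp [K, ENNReal.mul_eq_top]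
  have hsplit : ∀ n, m n (Metric.ball x₀ (min δ δ₀))ᶜ ≤ m n B + m n B' := fun n =>
    (measure_mono hBB').trans (measure_union_le _ _)
  have hBm : ∀ᶠ n in atTop, m n B = normalize (m n) B * m n Set.univ := by
    filter_upwards [hfin] with n hn
    rw [normalize, Measure.smul_apply, smul_eq_mul, mul_right_comm, ENNReal.inv_mul_cancel hn.1 hn.2,
      one_mul]
  have hbd : ∀ᶠ n in atTop, a n * m n Set.univ ≤ 2 * K := by
    filter_upwards [hfin, hBm, hlocfin, hloclim.eventually_lt_const (lt_add_one Z),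
      hB'.eventually_lt_const (by simp : (0 : ENNReal) < 1),
      hB.eventually_lt_const (by simp : (0 : ENNReal) < 2⁻¹)] with n h1 h2 h3 h4 h5 h6
    have hball : a n * m n (Metric.ball x₀ (min δ δ₀)) ≤ ENNReal.ofReal (Z + 1) := by
      rw [← ENNReal.ofReal_toReal h3.ne, ← ENNReal.ofReal_mul (laplaceScale_nonneg n)]
      exact ENNReal.ofReal_le_ofReal h4.le
    have htop : a n * m n Set.univ ≠ ⊤ := ENNReal.mul_ne_top ENNReal.ofReal_ne_top h1.2
    have hle : a n * m n Set.univ ≤ K + 2⁻¹ * (a n * m n Set.univ) := by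
      calc a n * m n Set.univ
          = a n * (m n (Metric.ball x₀ (min δ δ₀)) + m n (Metric.ball x₀ (min δ δ₀))ᶜ) := by
            rw [measure_add_measure_compl Metric.isOpen_ball.measurableSet]
        _ ≤ a n * (m n (Metric.ball x₀ (min δ δ₀)) + (2⁻¹ * m n Set.univ + m n B')) := by
            gcongr
            refine (hsplit n).trans ?_
            rw [h2]
            gcongr
        _ = a n * m n (Metric.ball x₀ (min δ δ₀)) + a n * m n B' +
            2⁻¹ * (a n * m n Set.univ) := by ring
        _ ≤ _ := add_le_add_left (add_le_add hball h5.le) _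
    have hhalf : a n * m n Set.univ = 2⁻¹ * (a n * m n Set.univ) + 2⁻¹ * (a n * m n Set.univ) := by
      rw [← add_mul, ENNReal.inv_two_add_inv_two, one_mul]
    have hle' : 2⁻¹ * (a n * m n Set.univ) ≤ K := by
      rw [hhalf] at hle htop
      exact (ENNReal.add_le_add_iff_right (ENNReal.add_ne_top.1 htop).1).1
        (by rwa [← hhalf] at hle ⊢)
    calc a n * m n Set.univ = 2 * (2⁻¹ * (a n * m n Set.univ)) := by
          rw [← mul_assoc, ENNReal.mul_inv_cancel (by simp) (by simp), one_mul]
      _ ≤ _ := by gcongr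
  have hlimB : Tendsto (fun n => a n * m n B) atTop (𝓝 0) := by
    have h1 : Tendsto (fun n => normalize (m n) B * (2 * K)) atTop (𝓝 0) := by
      simpa using ENNReal.Tendsto.mul_const (b := 2 * K) hB (Or.inr hK)
    refine tendsto_of_tendsto_of_tendsto_of_le_of_le' tendsto_const_nhds h1
      (Eventually.of_forall fun _ => zero_le) ?_
    filter_upwards [hbd, hBm] with n h2 h3
    rw [h3, mul_left_comm]
    gcongr
  refine tendsto_of_tendsto_of_tendsto_of_le_of_le tendsto_const_nhds
    (by simpa using hlimB.add hB') (fun _ => zero_le) fun n => ?_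
  rw [← mul_add]
  gcongr
  refine (measure_mono ?_).trans (hsplit n)
  exact Set.compl_subset_compl.2 (Metric.ball_subset_ball (min_le_left _ _))

end LaplaceFamily

end Bridged

/-! ### Asymptotic variances -/

namespace Bridged

section Shear

variable {V W : Type*} [NormedAddCommGroup V] [NormedSpace ℝ V] [FiniteDimensional ℝ V]
  [MeasurableSpace V] [BorelSpace V] {μ : Measure V} [μ.IsAddHaarMeasure]
  [NormedAddCommGroup W] [NormedSpace ℝ W] [FiniteDimensional ℝ W]
  [MeasurableSpace W] [BorelSpace W] {ν : Measure W} [ν.IsAddHaarMeasure]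

/-- `gaussLaw` is transported by measure-preserving changes of coordinates. -/
theorem map_gaussLaw_comp {T : V → V} (hT : MeasurePreserving T μ μ) (hTc : Continuous T)
    (hTi : Function.Injective T) {Q : V → ℝ} (hQ : Continuous Q)
    (hc : ∃ c > 0, ∀ u, c * ‖u‖ ^ 2 ≤ Q u) (hc' : ∃ c > 0, ∀ u, c * ‖u‖ ^ 2 ≤ Q (T u)) :
    (gaussLaw μ fun u => Q (T u)).map T = gaussLaw μ Q := by
  have := isProbabilityMeasure_gaussLaw (μ := μ) hQ hc
  have hQT : Continuous fun u => Q (T u) := hQ.comp hTc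
  have := isProbabilityMeasure_gaussLaw (μ := μ) hQT hc'
  have := Measure.isProbabilityMeasure_map (μ := gaussLaw μ fun u => Q (T u))
    hTc.measurable.aemeasurable
  have hemb : MeasurableEmbedding T := hTc.measurableEmbedding hTi
  refine ext_of_forall_integral_eq_of_IsFiniteMeasure fun f => ?_
  rw [integral_map hTc.measurable.aemeasurable (by fun_prop), integral_gaussLaw hQ,
    integral_gaussLaw hQT, ← hT.integral_comp hemb fun u => f u * Real.exp (-Q u / 2),
    ← hT.integral_comp hemb fun u => Real.exp (-Q u / 2)]

/-- Completing the square: if `A` splits as `A (u, J u + ξ) = A (u, J u) + A (0, ξ)`, then the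
`W`-marginal of the Gaussian law with precision `A` is the law of `J u + ξ` with independent `u` and
`ξ`, so its variances exceed those of `J u`. -/
theorem variance_gaussLaw_lt {A : V × W → ℝ} (hA : Continuous A)
    (hc : ∃ c > 0, ∀ u, c * ‖u‖ ^ 2 ≤ A u) {J : V →L[ℝ] W}
    (hJ : ∀ u ξ, A (u, J u + ξ) = A (u, J u) + A (0, ξ)) {l : W →L[ℝ] ℝ} (hl : l ≠ 0) :
    variance (fun u => l (J u)) (gaussLaw μ fun u => A (u, J u)) <
      variance (fun x : V × W => l x.2) (gaussLaw (μ.prod ν) A) := by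
  obtain ⟨c, hc0, hcA⟩ := id hc
  have hQH : Continuous fun u => A (u, J u) := by fun_prop
  have hQB : Continuous fun ξ => A (0, ξ) := by fun_prop
  have hcH : ∃ c > 0, ∀ u, c * ‖u‖ ^ 2 ≤ A (u, J u) := ⟨c, hc0, fun u => by
    refine le_trans ?_ (hcA (u, J u))
    gcongr
    exact norm_fst_le (u, J u)⟩
  have hcB : ∃ c > 0, ∀ ξ, c * ‖ξ‖ ^ 2 ≤ A (0, ξ) := ⟨c, hc0, fun ξ => by
    refine le_trans ?_ (hcA (0, ξ))
    gcongr
    exact norm_snd_le ((0 : V), ξ)⟩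
  have := isProbabilityMeasure_gaussLaw (μ := μ) hQH hcH
  have := isProbabilityMeasure_gaussLaw (μ := ν) hQB hcB
  let T : V × W → V × W := fun x => (x.1, J x.1 + x.2)
  have hTc : Continuous T := by fun_prop
  have hTi : Function.Injective T := by
    rintro ⟨a, b⟩ ⟨a', b'⟩ h
    simp only [T, Prod.mk.injEq] at h
    obtain ⟨rfl, h⟩ := h
    simpa using h
  have hT : MeasurePreserving T (μ.prod ν) (μ.prod ν) :=
    (MeasurePreserving.id μ).skew_product (g := fun a b => J a + b)
      (by simp only [Function.uncurry_def]; fun_prop)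
      (ae_of_all _ fun a => map_add_left_eq_self ν (J a))
  have hprod : (gaussLaw μ fun u => A (u, J u)).prod (gaussLaw ν fun ξ => A (0, ξ)) =
      gaussLaw (μ.prod ν) fun x => A (T x) := by
    rw [gaussLaw_prod hQH hcH hQB hcB]
    congr 1
    ext x
    exact (hJ x.1 x.2).symm
  have hcT : ∃ c > 0, ∀ x, c * ‖x‖ ^ 2 ≤ A (T x) := by
    obtain ⟨a, ha, hH⟩ := hcH
    obtain ⟨b, hb, hB⟩ := hcB
    refine ⟨min a b, lt_min ha hb, fun x => ?_⟩
    have h1 : A (T x) = A (x.1, J x.1) + A (0, x.2) := hJ x.1 x.2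
    have h2 := hH x.1
    have h3 := hB x.2
    have h4 : 0 ≤ a * ‖x.1‖ ^ 2 := by positivity
    have h5 : 0 ≤ b * ‖x.2‖ ^ 2 := by positivity
    rw [h1]
    rcases max_choice ‖x.1‖ ‖x.2‖ with h | h <;> rw [Prod.norm_def, h]
    · nlinarith [mul_le_mul_of_nonneg_right (min_le_left a b) (sq_nonneg ‖x.1‖)]
    · nlinarith [mul_le_mul_of_nonneg_right (min_le_right a b) (sq_nonneg ‖x.2‖)]
  have hX : MemLp (fun x : V × W => l (J x.1))
      2 ((gaussLaw μ fun u => A (u, J u)).prod (gaussLaw ν fun ξ => A (0, ξ))) :=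
    (memLp_two_gaussLaw (μ := μ) hQH hcH (l.comp J)).comp_measurePreserving measurePreserving_fst
  have hY : MemLp (fun x : V × W => l x.2)
      2 ((gaussLaw μ fun u => A (u, J u)).prod (gaussLaw ν fun ξ => A (0, ξ))) :=
    (memLp_two_gaussLaw (μ := ν) hQB hcB l).comp_measurePreserving measurePreserving_snd
  have hindep := indepFun_prod (μ := gaussLaw μ fun u => A (u, J u))
    (ν := gaussLaw ν fun ξ => A (0, ξ)) (X := fun u => l (J u)) (Y := fun ξ => l ξ)
    (by fun_prop) (by fun_prop)
  have hvar := hindep.variance_add hX hY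
  have h1 : variance (fun x : V × W => l (J x.1))
      ((gaussLaw μ fun u => A (u, J u)).prod (gaussLaw ν fun ξ => A (0, ξ))) =
      variance (fun u => l (J u)) (gaussLaw μ fun u => A (u, J u)) := by
    conv_rhs => rw [← (measurePreserving_fst (μ := gaussLaw μ fun u => A (u, J u))
      (ν := gaussLaw ν fun ξ => A (0, ξ))).map_eq]
    rw [variance_map (by fun_prop) (by fun_prop)]
    rfl
  have h2 : variance (fun x : V × W => l x.2)
      ((gaussLaw μ fun u => A (u, J u)).prod (gaussLaw ν fun ξ => A (0, ξ))) =
      variance (fun ξ => l ξ) (gaussLaw ν fun ξ => A (0, ξ)) := by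
    conv_rhs => rw [← (measurePreserving_snd (μ := gaussLaw μ fun u => A (u, J u))
      (ν := gaussLaw ν fun ξ => A (0, ξ))).map_eq]
    rw [variance_map (by fun_prop) (by fun_prop)]
    rfl
  have h3 : variance (fun x : V × W => l x.2) (gaussLaw (μ.prod ν) A) =
      variance ((fun x : V × W => l (J x.1)) + fun x => l x.2)
        ((gaussLaw μ fun u => A (u, J u)).prod (gaussLaw ν fun ξ => A (0, ξ))) := by
    rw [← map_gaussLaw_comp hT hTc hTi hA hc hcT, variance_map (by fun_prop) (by fun_prop), hprod]
    congr 1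
    ext x
    simp [T]
  rw [h3, hvar, h1, h2]
  exact lt_add_of_pos_right _ (variance_gaussLaw_pos hQB hcB hl)

end Shear

/-- Weak limits are unique, so asymptotic variances are. -/
theorem HasAsymptoticVariance.unique {k : ℕ} {m : ℕ → Measure (Vec k)} {v w : Fin k → ℝ}
    (hv : HasAsymptoticVariance m v) (hw : HasAsymptoticVariance m w) : v = w := by
  obtain ⟨ν, hν, hlim, hvar⟩ := hv
  obtain ⟨ν', hν', hlim', hvar'⟩ := hw
  have : ν = ν' := ext_of_forall_integral_eq_of_IsFiniteMeasure fun f =>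
    tendsto_nhds_unique (hlim f) (hlim' f)
  subst this
  exact funext fun j => (hvar j).2.symm.trans (hvar' j).2

/-- Statistics `T n` whose rescaled limit at the centers is linear have the asymptotic variances of
the image of the limiting Gaussian law. -/
theorem LaplaceFamily.hasAsymptoticVariance {V : Type*} [NormedAddCommGroup V] [NormedSpace ℝ V]
    [FiniteDimensional ℝ V] [MeasurableSpace V] [BorelSpace V] {μ : Measure V} [μ.IsAddHaarMeasure]
    {S : Set V} {ρ : V → ℝ} {Λ F : ℕ → V → ℝ} {x : ℕ → V} {x₀ : V} {c₀ : ℝ} {Q : V → ℝ}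
    (h : LaplaceFamily μ S ρ Λ F x x₀ c₀ Q)
    (hfar : ∀ δ > 0, Tendsto (fun n => ENNReal.ofReal (laplaceScale F x n) *
      posteriorMeasure μ S ρ Λ n (Metric.ball x₀ δ)ᶜ) atTop (𝓝 0))
    {k : ℕ} {T : ℕ → V → Vec k} {T₀ : V →L[ℝ] Vec k}
    (hTm : ∀ᶠ n in atTop, AEMeasurable (T n) (μ.restrict S))
    (hT : ∀ u, Tendsto (fun n => T n (x n + (√(n : ℝ))⁻¹ • u)) atTop (𝓝 (T₀ u))) :
    HasAsymptoticVariance (fun n => (normalize (posteriorMeasure μ S ρ Λ n)).map (T n))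
      (fun j => variance (fun u => T₀ u j) (gaussLaw μ Q)) := by
  have := isProbabilityMeasure_gaussLaw (μ := μ) h.form_continuous h.form_coercive
  have hT₀ : AEMeasurable (fun u => T₀ u) (gaussLaw μ Q) := by fun_prop
  refine ⟨(gaussLaw μ Q).map T₀, Measure.isProbabilityMeasure_map hT₀, fun f => ?_, fun j => ?_⟩
  · rw [integral_map hT₀ (by fun_prop)]
    have hψm : ∀ᶠ n in atTop, AEStronglyMeasurable (fun z => f (T n z)) (μ.restrict S) := by
      filter_upwards [hTm] with n hn
      exact f.continuous.comp_aestronglyMeasurable hn.aestronglyMeasurable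
    have hlim := (h.tendsto_integral_normalize hfar (ψ := fun n z => f (T n z))
      (Ψ := fun u => f (T₀ u)) (M := ‖f‖) hψm (fun n z => f.norm_coe_le_norm _)
      (fun u => (f.continuous.tendsto _).comp (hT u))).2
    refine hlim.congr' ?_
    filter_upwards [hTm] with n hn
    have hac : normalize (posteriorMeasure μ S ρ Λ n) ≪ μ.restrict S :=
      (withDensity_absolutelyContinuous _ _).smul_left _
    rw [integral_map (hn.mono_ac hac) (by fun_prop)]
  · have hL := memLp_two_gaussLaw (μ := μ) h.form_continuous h.form_coercive
      ((EuclideanSpace.proj (𝕜 := ℝ) j).comp T₀)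
    refine ⟨(memLp_map_measure_iff (by fun_prop) hT₀).2 hL, ?_⟩
    rw [variance_map (by fun_prop) hT₀]
    rfl

/-- Tightness: the laws of a weakly convergent sequence give vanishing mass to sets that escape to
infinity. -/
theorem tendsto_measure_norm_ge {W : Type*} [NormedAddCommGroup W] [MeasurableSpace W] [BorelSpace W]
    {m : ℕ → Measure W} {ν : Measure W} [IsProbabilityMeasure ν]
    (hm : ∀ᶠ n in atTop, IsProbabilityMeasure (m n))
    (hlim : ∀ f : W →ᵇ ℝ, Tendsto (fun n => ∫ x, f x ∂m n) atTop (𝓝 (∫ x, f x ∂ν)))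
    {t : ℕ → ℝ} (ht : Tendsto t atTop atTop) :
    Tendsto (fun n => m n {z | t n ≤ ‖z‖}) atTop (𝓝 0) := by
  -- `cut N` vanishes on the ball of radius `N` and equals one outside the ball of radius `N + 1`
  let cut : ℕ → W →ᵇ ℝ := fun N => BoundedContinuousFunction.ofNormedAddCommGroup
    (fun z => min 1 (max 0 (‖z‖ - N))) (by fun_prop) 1 (fun z => by
      rw [Real.norm_of_nonneg (le_min zero_le_one (le_max_left _ _))]
      exact min_le_left _ _)
  have hcut : Tendsto (fun N => ∫ z, cut N z ∂ν) atTop (𝓝 0) := by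
    rw [← integral_zero W ℝ (μ := ν)]
    refine tendsto_integral_of_dominated_convergence (fun _ => 1)
      (fun N => (cut N).continuous.aestronglyMeasurable) (integrable_const _)
      (fun N => ae_of_all _ fun z => ?_) (ae_of_all _ fun z => ?_)
    · exact (Real.norm_of_nonneg (le_min zero_le_one (le_max_left 0 (‖z‖ - N)))).trans_le
        (min_le_left _ _)
    · refine tendsto_const_nhds.congr' ?_
      filter_upwards [tendsto_natCast_atTop_atTop.eventually (eventually_ge_atTop ‖z‖)] with N hN
      change 0 = min 1 (max 0 (‖z‖ - N))
      rw [max_eq_left (by linarith), min_eq_right zero_le_one]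
  have hreal : Tendsto (fun n => (m n).real {z | t n ≤ ‖z‖}) atTop (𝓝 0) := by
    rw [Metric.tendsto_nhds]
    intro ε hε
    obtain ⟨N, hN⟩ := (hcut.eventually_lt_const hε).exists
    filter_upwards [hm, (hlim (cut N)).eventually_lt_const hN,
      ht.eventually (eventually_ge_atTop (N + 1 : ℝ))] with n h1 h2 h3
    rw [Real.dist_0_eq_abs, abs_of_nonneg measureReal_nonneg]
    refine lt_of_le_of_lt ?_ h2
    have hset : MeasurableSet {z : W | t n ≤ ‖z‖} := measurableSet_le (by fun_prop) (by fun_prop)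
    rw [← integral_indicator_one hset]
    refine integral_mono ((integrable_const 1).indicator hset)
      ((cut N).integrable _) fun z => ?_
    change _ ≤ min 1 (max 0 (‖z‖ - N))
    by_cases hz : z ∈ {z : W | t n ≤ ‖z‖}
    · have hz' : t n ≤ ‖z‖ := hz
      rw [Set.indicator_of_mem hz, le_min_iff]
      exact ⟨le_rfl, le_max_of_le_right (by simp only [Pi.one_apply]; linarith)⟩
    · rw [Set.indicator_of_notMem hz]
      exact le_min zero_le_one (le_max_left _ _)
  have := ENNReal.tendsto_ofReal hreal
  rw [ENNReal.ofReal_zero] at this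
  refine this.congr' ?_
  filter_upwards [hm] with n hn
  rw [Measure.real, ENNReal.ofReal_toReal (measure_ne_top _ _)]

end Bridged

/-! ### The profile likelihood -/

namespace Bridged

variable {𝒴 : Type*} {d p : ℕ}

/-- The average log-likelihood `lₙ` as a function of the pair `(lam, ζ)`. -/
noncomputable abbrev Model.ellPair (M : Model 𝒴 d p) (y : ℕ → 𝒴) (n : ℕ) (x : Vec d × Vec p) : ℝ :=
  M.ell y n x.1 x.2

/-- The assumptions on a single data sequence `y` (profile likelihood, well-posedness and
`A1`, `A2`, `A3`, `A4Inside`, `A4Outside` for a compact set `K`). -/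
structure RegularData (M : Model 𝒴 d p) (E K : Set (Vec d)) (lam₀ : Vec d) (zstar : Vec d → Vec p)
    (lstar : Vec d × Vec p → ℝ) (y : ℕ → 𝒴) : Prop where
  isOpen : IsOpen E
  subset : E ⊆ M.Θ
  mem : lam₀ ∈ E
  profile : M.IsProfile
  wellPosed : M.WellPosed y
  a1 : M.A1 E y
  a2 : M.A2 zstar lstar y
  a3 : A3 lam₀ zstar lstar
  compact : IsCompact K
  compact_subset : K ⊆ E
  a4_inside : A4Inside K E lam₀ zstar lstar
  a4_outside : M.A4Outside K (lstar (lam₀, zstar lam₀)) y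

namespace RegularData

variable {M : Model 𝒴 d p} {E K : Set (Vec d)} {lam₀ : Vec d} {zstar : Vec d → Vec p}
  {lstar : Vec d × Vec p → ℝ} {y : ℕ → 𝒴}

theorem zhat_mem (h : RegularData M E K lam₀ zstar lstar y) {n : ℕ} (hn : 0 < n) {lam : Vec d}
    (hlam : lam ∈ M.Θ) : M.zhat y n lam ∈ M.Z :=
  (argminOn_spec ((h.wellPosed n hn).1 lam hlam)).1

/-- For the profile likelihood, `ẑₙ(lam)` maximizes `lₙ(lam, ·)`. -/
theorem ell_le_ellHat (h : RegularData M E K lam₀ zstar lstar y) {n : ℕ} (hn : 0 < n) {lam : Vec d}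
    (hlam : lam ∈ M.Θ) {ζ : Vec p} (hζ : ζ ∈ M.Z) : M.ell y n lam ζ ≤ M.ellHat y n lam := by
  have h1 := (argminOn_spec ((h.wellPosed n hn).1 lam hlam)).2 ζ hζ
  rw [h.profile, h.profile, neg_le_neg_iff] at h1
  exact div_le_div_of_nonneg_right (Real.log_le_log (M.L_pos _ _ _ hlam _ hζ) h1) (Nat.cast_nonneg n)

theorem likelihood_eq_exp {n : ℕ} (hn : 0 < n) {lam : Vec d} (hlam : lam ∈ M.Θ) {ζ : Vec p}
    (hζ : ζ ∈ M.Z) : M.L n (fun i => y i) lam ζ = Real.exp (n * M.ell y n lam ζ) := by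
  have hn' : (n : ℝ) ≠ 0 := Nat.cast_ne_zero.2 hn.ne'
  rw [Model.ell, mul_div_cancel₀ _ hn', Real.exp_log (M.L_pos _ _ _ hlam _ hζ)]

/-- Around each point of the graph of `ẑ_*` over `E`, `A1` and `A2` hold on a fixed ball. -/
theorem exists_uniformlyC3 (h : RegularData M E K lam₀ zstar lstar y) {lam : Vec d} (hlam : lam ∈ E) :
    ∃ r > 0, Metric.ball lam r ⊆ E ∧ Metric.ball (zstar lam) r ⊆ M.Z ∧
      UniformlyC3 (M.zhat y) zstar lam r ∧
      UniformlyC3 (M.ellPair y) lstar (lam, zstar lam) r := by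
  obtain ⟨⟨U, hU, hUr, hC3, C, hC⟩, hz3, C', hC'⟩ := h.a1
  obtain ⟨r₁, hr₁, hE⟩ := Metric.isOpen_iff.1 h.isOpen lam hlam
  obtain ⟨r₂, hr₂, hball⟩ := hUr lam hlam
  set r := min r₁ (r₂ / 2)
  have hr : 0 < r := lt_min hr₁ (half_pos hr₂)
  have hrE : Metric.ball lam r ⊆ E := (Metric.ball_subset_ball (min_le_left _ _)).trans hE
  have hzU : ∀ᶠ n in atTop, 0 < n ∧ Metric.ball (zstar lam) r ⊆ U n := by
    filter_upwards [eventually_gt_atTop 0, (h.a2.1 lam (h.subset hlam)).eventually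
      (Metric.ball_mem_nhds _ (half_pos hr₂))] with n hn hnear
    refine ⟨hn, fun z hz => hball n hn ?_⟩
    have h1 : dist z (zstar lam) < r₂ / 2 := lt_of_lt_of_le hz (min_le_right _ _)
    have h2 : dist (M.zhat y n lam) (zstar lam) < r₂ / 2 := hnear
    rw [Metric.mem_ball]
    linarith [dist_triangle_right z (M.zhat y n lam) (zstar lam)]
  have hZ : Metric.ball (zstar lam) r ⊆ M.Z := by
    obtain ⟨n, hn, hsub⟩ := hzU.exists
    exact hsub.trans (hU n hn).2.1
  refine ⟨r, hr, hrE, hZ, ⟨hr, ⟨C', ?_⟩, fun x hx => h.a2.1 x (h.subset (hrE hx))⟩,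
    ⟨hr, ⟨C, ?_⟩, fun x hx => ?_⟩⟩
  · filter_upwards [eventually_gt_atTop 0] with n hn
    exact ⟨(hz3 n hn).mono hrE, fun x hx => hC' n hn x (hrE hx)⟩
  · filter_upwards [hzU] with n hn
    have hsub : Metric.ball (lam, zstar lam) r ⊆ E ×ˢ U n := by
      rw [← ball_prod_same]
      exact Set.prod_mono hrE hn.2
    exact ⟨(hC3 n hn.1).mono hsub, fun x hx => hC n hn.1 x (hsub hx)⟩
  · rw [← ball_prod_same] at hx
    exact h.a2.2 x.1 (h.subset (hrE hx.1)) x.2 (hZ hx.2)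

theorem tendsto_graph (h : RegularData M E K lam₀ zstar lstar y) {lam : Vec d} (hlam : lam ∈ E) :
    Tendsto (fun q : ℕ × Vec d => (q.2, M.zhat y q.1 q.2)) (atTop ×ˢ 𝓝 lam)
      (𝓝 (lam, zstar lam)) := by
  obtain ⟨r, -, -, -, hz, -⟩ := h.exists_uniformlyC3 hlam
  exact tendsto_snd.prodMk_nhds hz.tendsto_prod

theorem tendsto_ellHat (h : RegularData M E K lam₀ zstar lstar y) {lam : Vec d} (hlam : lam ∈ E) :
    Tendsto (fun q : ℕ × Vec d => M.ellHat y q.1 q.2) (atTop ×ˢ 𝓝 lam)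
      (𝓝 (lstar (lam, zstar lam))) := by
  obtain ⟨r, -, -, -, -, hl⟩ := h.exists_uniformlyC3 hlam
  exact hl.tendsto_prod.comp (tendsto_fst.prodMk (h.tendsto_graph hlam))

/-- Away from `lam₀`, the profile log-likelihood is eventually separated from its limiting maximum:
on `K` by compactness and `A4Inside`, outside `K` by `A4Outside`. -/
theorem exists_ellHat_le (h : RegularData M E K lam₀ zstar lstar y) {δ : ℝ} (hδ : 0 < δ) :
    ∃ c < lstar (lam₀, zstar lam₀), ∀ᶠ n in atTop, ∀ lam ∈ M.Θ \ Metric.ball lam₀ δ,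
      M.ellHat y n lam ≤ c := by
  have hcomp : ∃ c < lstar (lam₀, zstar lam₀), ∀ᶠ n in atTop, ∀ lam ∈ K \ Metric.ball lam₀ δ,
      M.ellHat y n lam ≤ c := by
    refine (h.compact.diff Metric.isOpen_ball).induction_on
      (p := fun s => ∃ c < lstar (lam₀, zstar lam₀), ∀ᶠ n in atTop, ∀ lam ∈ s, M.ellHat y n lam ≤ c)
      ⟨_, sub_one_lt _, by simp⟩ ?_ ?_ ?_
    · rintro s t hst ⟨c, hc, ht⟩
      exact ⟨c, hc, ht.mono fun n hn lam hlam => hn lam (hst hlam)⟩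
    · rintro s t ⟨c, hc, hs⟩ ⟨c', hc', ht⟩
      refine ⟨max c c', max_lt hc hc', ?_⟩
      filter_upwards [hs, ht] with n h1 h2 lam hlam
      rcases hlam with hlam | hlam
      · exact (h1 lam hlam).trans (le_max_left _ _)
      · exact (h2 lam hlam).trans (le_max_right _ _)
    · rintro lam ⟨hK, hball⟩
      have hne : lam ≠ lam₀ := by
        rintro rfl
        exact hball (Metric.mem_ball_self hδ)
      have hE := h.compact_subset hK
      have hlt := h.a4_inside lam ⟨hK, hne⟩ _ ⟨lam, hE, rfl⟩
      obtain ⟨c, hc1, hc2⟩ := exists_between hlt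
      obtain ⟨P, hP, R, hR, hPR⟩ := eventually_prod_iff.1
        ((h.tendsto_ellHat hE).eventually_lt_const hc1)
      exact ⟨{x | R x}, mem_nhdsWithin_of_mem_nhds hR, c, hc2,
        hP.mono fun n hn x hx => (hPR hn hx).le⟩
  obtain ⟨c, hc, hin⟩ := hcomp
  obtain ⟨c', hc', hout⟩ := h.a4_outside
  refine ⟨max c c', max_lt hc hc', ?_⟩
  filter_upwards [hin, hout] with n h1 h2 lam hlam
  by_cases hK : lam ∈ K
  · exact (h1 lam ⟨hK, hlam.2⟩).trans (le_max_left _ _)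
  · exact (h2 lam ⟨hlam.1, hK⟩ _ ⟨lam, hlam.1, rfl⟩).trans (le_max_right _ _)

/-- Near `lam₀`, `ẑₙ` and `lₙ` are differentiable along the graph of `ẑₙ`, and the derivative of
`lₙ` in `ζ` vanishes there. -/
theorem eventually_hasFDerivAt (h : RegularData M E K lam₀ zstar lstar y) :
    ∀ᶠ q : ℕ × Vec d in atTop ×ˢ 𝓝 lam₀,
      HasFDerivAt (M.zhat y q.1) (fderiv ℝ (M.zhat y q.1) q.2) q.2 ∧
      HasFDerivAt (M.ellPair y q.1)
        (fderiv ℝ (M.ellPair y q.1) (q.2, M.zhat y q.1 q.2)) (q.2, M.zhat y q.1 q.2) ∧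
      HasFDerivAt (fderiv ℝ (M.ellPair y q.1))
        (fderiv ℝ (fderiv ℝ (M.ellPair y q.1)) (q.2, M.zhat y q.1 q.2)) (q.2, M.zhat y q.1 q.2) ∧
      (∀ u v, fderiv ℝ (fderiv ℝ (M.ellPair y q.1)) (q.2, M.zhat y q.1 q.2) u v =
        fderiv ℝ (fderiv ℝ (M.ellPair y q.1)) (q.2, M.zhat y q.1 q.2) v u) ∧
      ∀ ξ, fderiv ℝ (M.ellPair y q.1) (q.2, M.zhat y q.1 q.2) (0, ξ) = 0 := by
  obtain ⟨r, hr, hE, hZ, hz, hl⟩ := h.exists_uniformlyC3 h.mem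
  obtain ⟨C, -, hzC⟩ := hz.exists_hasLipschitzHessian
  obtain ⟨C', -, hlC⟩ := hl.exists_hasLipschitzHessian
  filter_upwards [((hzC.and hlC).and (eventually_gt_atTop 0)).prod_mk (Metric.ball_mem_nhds lam₀ hr),
    (h.tendsto_graph h.mem).eventually (Metric.ball_mem_nhds _ hr)] with q hq hgraph
  obtain ⟨⟨⟨hqz, hql⟩, hq0⟩, hq2⟩ := hq
  refine ⟨hqz.hasFDerivAt _ hq2, hql.hasFDerivAt _ hgraph, hql.hasFDerivAt_fderiv _ hgraph,
    hql.symm _ hgraph, fun ξ => ?_⟩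
  have hgr : M.zhat y q.1 q.2 ∈ Metric.ball (zstar lam₀) r := by
    have h1 : (q.2, M.zhat y q.1 q.2) ∈ Metric.ball (lam₀, zstar lam₀) r := hgraph
    rw [← ball_prod_same] at h1
    exact h1.2
  have hmax : IsLocalMax (fun ζ => M.ellPair y q.1 (q.2, ζ)) (M.zhat y q.1 q.2) := by
    filter_upwards [Metric.isOpen_ball.mem_nhds hgr] with ζ hζ
    exact h.ell_le_ellHat hq0 (h.subset (hE hq2)) (hZ hζ)
  have hder : HasFDerivAt (fun ζ => M.ellPair y q.1 (q.2, ζ))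
      ((fderiv ℝ (M.ellPair y q.1) (q.2, M.zhat y q.1 q.2)).comp
        (ContinuousLinearMap.inr ℝ (Vec d) (Vec p))) (M.zhat y q.1 q.2) :=
    (hql.hasFDerivAt _ hgraph).comp _ (hasFDerivAt_prodMk_right q.2 _)
  exact congrArg (fun D => D ξ) (hmax.hasFDerivAt_eq_zero hder)

theorem eventually_hasFDerivAt_ellHat (h : RegularData M E K lam₀ zstar lstar y) :
    ∀ᶠ q : ℕ × Vec d in atTop ×ˢ 𝓝 lam₀,
      HasFDerivAt (M.ellHat y q.1) ((fderiv ℝ (M.ellPair y q.1) (q.2, M.zhat y q.1 q.2)).comp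
        ((ContinuousLinearMap.id ℝ (Vec d)).prod (fderiv ℝ (M.zhat y q.1) q.2))) q.2 := by
  filter_upwards [h.eventually_hasFDerivAt] with q hq
  exact HasFDerivAt.comp (g := M.ellPair y q.1) (f := fun lam => (lam, M.zhat y q.1 lam)) q.2
    hq.2.1 ((hasFDerivAt_id q.2).prodMk hq.1)

/-- Maximizers of the profile likelihood over a small closed ball are centers. -/
theorem exists_isCenter (h : RegularData M E K lam₀ zstar lstar y) :
    ∃ lamn : ℕ → Vec d, M.IsCenter lam₀ y lamn := by
  obtain ⟨P, hP, R, hR, hPR⟩ := eventually_prod_iff.1 h.eventually_hasFDerivAt_ellHat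
  obtain ⟨δ, hδ, hδR⟩ := Metric.nhds_basis_closedBall.mem_iff.1
    (inter_mem hR (h.isOpen.mem_nhds h.mem))
  have hex : ∀ n, ∃ lam ∈ Metric.closedBall lam₀ δ,
      ContinuousOn (M.ellHat y n) (Metric.closedBall lam₀ δ) →
        IsMaxOn (M.ellHat y n) (Metric.closedBall lam₀ δ) lam := by
    intro n
    by_cases hc : ContinuousOn (M.ellHat y n) (Metric.closedBall lam₀ δ)
    · obtain ⟨lam, hlam, hmax⟩ := (isCompact_closedBall lam₀ δ).exists_isMaxOn
        ⟨lam₀, Metric.mem_closedBall_self hδ.le⟩ hc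
      exact ⟨lam, hlam, fun _ => hmax⟩
    · exact ⟨lam₀, Metric.mem_closedBall_self hδ.le, fun h => absurd h hc⟩
  choose lamn hmem hmax using hex
  have hmax' : ∀ᶠ n in atTop, IsMaxOn (M.ellHat y n) (Metric.closedBall lam₀ δ) (lamn n) := by
    filter_upwards [hP] with n hn
    exact hmax n fun lam hlam => (hPR hn (hδR hlam).1).continuousAt.continuousWithinAt
  have hval : Tendsto (fun n => M.ellHat y n lam₀) atTop (𝓝 (lstar (lam₀, zstar lam₀))) :=
    (h.tendsto_ellHat h.mem).comp (tendsto_id.prodMk tendsto_const_nhds)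
  have hlim : Tendsto lamn atTop (𝓝 lam₀) := by
    rw [Metric.tendsto_nhds]
    intro ε hε
    obtain ⟨c, hc, hle⟩ := h.exists_ellHat_le hε
    filter_upwards [hmax', hle, hval.eventually_const_lt hc] with n h1 h2 h3
    by_contra hfar
    have h4 := h2 (lamn n) ⟨h.subset (hδR (hmem n)).2, hfar⟩
    have h5 := isMaxOn_iff.1 h1 lam₀ (Metric.mem_closedBall_self hδ.le)
    linarith
  refine ⟨lamn, hlim, ?_⟩
  filter_upwards [hP, hmax', hlim.eventually (Metric.ball_mem_nhds lam₀ hδ)] with n h1 h2 h3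
  have hder := hPR h1 (hδR (hmem n)).1
  have hloc : IsLocalMax (M.ellHat y n) (lamn n) := h2.isLocalMax
    (Filter.mem_of_superset (Metric.isOpen_ball.mem_nhds h3) Metric.ball_subset_closedBall)
  rwa [hloc.hasFDerivAt_eq_zero hder] at hder

/-- At a center, the full log-likelihood is critical. -/
theorem eventually_fderiv_eq_zero (h : RegularData M E K lam₀ zstar lstar y) {lamn : ℕ → Vec d}
    (hc : M.IsCenter lam₀ y lamn) :
    ∀ᶠ n in atTop, fderiv ℝ (M.ellPair y n) (lamn n, M.zhat y n (lamn n)) = 0 := by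
  have hq : Tendsto (fun n => (n, lamn n)) atTop (atTop ×ˢ 𝓝 lam₀) := tendsto_id.prodMk hc.1
  filter_upwards [hc.2, hq.eventually h.eventually_hasFDerivAt,
    hq.eventually h.eventually_hasFDerivAt_ellHat] with n h1 h2 h3
  have h4 := h3.unique h1
  have hζ := h2.2.2.2.2
  refine ContinuousLinearMap.ext fun v => ?_
  have h5 := congrArg (fun D => D v.1) h4
  simp only [ContinuousLinearMap.comp_apply, ContinuousLinearMap.prod_apply,
    ContinuousLinearMap.id_apply, zero_apply] at h5
  have h6 := hζ (v.2 - fderiv ℝ (M.zhat y n) (lamn n) v.1)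
  have h7 : v = (v.1, fderiv ℝ (M.zhat y n) (lamn n) v.1) +
      (0, v.2 - fderiv ℝ (M.zhat y n) (lamn n) v.1) := by
    ext <;> simp
  rw [h7, map_add, h5, h6]
  simp

/-- The graph of `ẑ_*'(lam₀)` is orthogonal to the `ζ`-directions for the limiting Hessian: the
derivative of the identity `∂lₙ/∂ζ (lam, ẑₙ(lam)) = 0`, in the limit. -/
theorem hessian_graph_eq_zero (h : RegularData M E K lam₀ zstar lstar y) (u : Vec d) (ξ : Vec p) :
    fderiv ℝ (fderiv ℝ lstar) (lam₀, zstar lam₀) (u, fderiv ℝ zstar lam₀ u) (0, ξ) = 0 ∧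
    fderiv ℝ (fderiv ℝ lstar) (lam₀, zstar lam₀) (0, ξ) (u, fderiv ℝ zstar lam₀ u) = 0 := by
  obtain ⟨r, hr, hE, hZ, hz, hl⟩ := h.exists_uniformlyC3 h.mem
  have hq : Tendsto (fun n : ℕ => (n, lam₀)) atTop (atTop ×ˢ 𝓝 lam₀) :=
    tendsto_id.prodMk tendsto_const_nhds
  have hJ : Tendsto (fun n => (u, fderiv ℝ (M.zhat y n) lam₀ u)) atTop
      (𝓝 (u, fderiv ℝ zstar lam₀ u)) :=
    tendsto_const_nhds.prodMk_nhds
      (tendsto_clm_apply (hz.tendsto_prod_fderiv.comp hq) (tendsto_const_nhds (x := u)))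
  have hH : Tendsto (fun n => fderiv ℝ (fderiv ℝ (M.ellPair y n)) (lam₀, M.zhat y n lam₀)) atTop
      (𝓝 (fderiv ℝ (fderiv ℝ lstar) (lam₀, zstar lam₀))) :=
    hl.tendsto_prod_hessian.comp (tendsto_id.prodMk ((h.tendsto_graph h.mem).comp hq))
  have hzero : ∀ᶠ n in atTop, fderiv ℝ (fderiv ℝ (M.ellPair y n)) (lam₀, M.zhat y n lam₀)
      (u, fderiv ℝ (M.zhat y n) lam₀ u) (0, ξ) = 0 ∧
      fderiv ℝ (fderiv ℝ (M.ellPair y n)) (lam₀, M.zhat y n lam₀)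
      (0, ξ) (u, fderiv ℝ (M.zhat y n) lam₀ u) = 0 := by
    filter_upwards [h.eventually_hasFDerivAt.curry] with n hn
    have h0 := hn.self_of_nhds
    have hgraph := h0.2.2.1.comp (f := fun lam => (lam, M.zhat y n lam)) lam₀
      ((hasFDerivAt_id lam₀).prodMk h0.1)
    have hder := hgraph.clm_apply (hasFDerivAt_const ((0 : Vec d), ξ) lam₀)
    have hconst : (fun lam => (fderiv ℝ (M.ellPair y n) ∘ fun lam => (lam, M.zhat y n lam)) lam
        ((0 : Vec d), ξ)) =ᶠ[𝓝 lam₀] fun _ => (0 : ℝ) := by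
      filter_upwards [hn] with lam hlam using hlam.2.2.2.2 ξ
    have h1 := congrArg (fun D => D u)
      (hder.unique ((hasFDerivAt_const (0 : ℝ) lam₀).congr_of_eventuallyEq hconst))
    have h2 : fderiv ℝ (fderiv ℝ (M.ellPair y n)) (lam₀, M.zhat y n lam₀)
      (u, fderiv ℝ (M.zhat y n) lam₀ u) (0, ξ) = 0 := by
      simpa using h1
    exact ⟨h2, (h0.2.2.2.1 _ _).trans h2⟩
  have hξ : Tendsto (fun _ : ℕ => ((0 : Vec d), ξ)) atTop (𝓝 (0, ξ)) := tendsto_const_nhds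
  exact ⟨tendsto_nhds_unique_of_eventuallyEq (tendsto_clm_apply (tendsto_clm_apply hH hJ) hξ)
      tendsto_const_nhds (hzero.mono fun n hn => hn.1),
    tendsto_nhds_unique_of_eventuallyEq (tendsto_clm_apply (tendsto_clm_apply hH hξ) hJ)
      tendsto_const_nhds (hzero.mono fun n hn => hn.2)⟩

end RegularData

end Bridged

/-! ### The limiting posteriors -/

namespace Bridged

variable {𝒴 : Type*} {d p : ℕ}

instance : (volume : Measure (Vec d × Vec p)).IsAddHaarMeasure :=
  inferInstanceAs (((volume : Measure (Vec d)).prod (volume : Measure (Vec p))).IsAddHaarMeasure)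

/-- The precision form `-l_*''` of the limiting full posterior. -/
noncomputable def precisionForm (lstar : Vec d × Vec p → ℝ) (x₀ u : Vec d × Vec p) : ℝ :=
  -fderiv ℝ (fderiv ℝ lstar) x₀ u u

theorem precisionForm_continuous (lstar : Vec d × Vec p → ℝ) (x₀ : Vec d × Vec p) :
    Continuous (precisionForm lstar x₀) := by
  unfold precisionForm
  fun_prop

theorem A3.precisionForm_pos {lam₀ : Vec d} {zstar : Vec d → Vec p} {lstar : Vec d × Vec p → ℝ}
    (h : A3 lam₀ zstar lstar) (v : Vec d × Vec p) (hv : v ≠ 0) :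
    0 < -fderiv ℝ (fderiv ℝ lstar) (lam₀, zstar lam₀) v v := by
  simpa [iteratedFDeriv_two_apply] using h.1 v hv

theorem A3.precisionForm_coercive {lam₀ : Vec d} {zstar : Vec d → Vec p}
    {lstar : Vec d × Vec p → ℝ} (h : A3 lam₀ zstar lstar) :
    ∃ c > 0, ∀ u, c * ‖u‖ ^ 2 ≤ precisionForm lstar (lam₀, zstar lam₀) u :=
  exists_mul_sq_norm_le (-fderiv ℝ (fderiv ℝ lstar) (lam₀, zstar lam₀)) h.precisionForm_pos

namespace RegularData

variable {M : Model 𝒴 d p} {E K : Set (Vec d)} {lam₀ : Vec d} {zstar : Vec d → Vec p}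
  {lstar : Vec d × Vec p → ℝ} {y : ℕ → 𝒴} {lamn : ℕ → Vec d}

theorem precisionForm_graph_add (h : RegularData M E K lam₀ zstar lstar y) (u : Vec d) (ξ : Vec p) :
    precisionForm lstar (lam₀, zstar lam₀) (u, fderiv ℝ zstar lam₀ u + ξ) =
      precisionForm lstar (lam₀, zstar lam₀) (u, fderiv ℝ zstar lam₀ u) +
      precisionForm lstar (lam₀, zstar lam₀) (0, ξ) := by
  have h1 : (u, fderiv ℝ zstar lam₀ u + ξ) = (u, fderiv ℝ zstar lam₀ u) + (0, ξ) := by simp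
  obtain ⟨h2, h3⟩ := h.hessian_graph_eq_zero u ξ
  simp only [precisionForm, h1, map_add, add_apply, h2, h3]
  ring

theorem variance_lt (h : RegularData M E K lam₀ zstar lstar y) (j : Fin p) :
    variance (fun u => fderiv ℝ zstar lam₀ u j) (gaussLaw volume fun u =>
        precisionForm lstar (lam₀, zstar lam₀) (u, fderiv ℝ zstar lam₀ u)) <
      variance (fun x : Vec d × Vec p => x.2 j)
        (gaussLaw volume (precisionForm lstar (lam₀, zstar lam₀))) := by
  have hproj : (EuclideanSpace.proj j : Vec p →L[ℝ] ℝ) ≠ 0 := fun h0 => by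
    have := congrArg (fun D : Vec p →L[ℝ] ℝ => D (EuclideanSpace.single j 1)) h0
    simp at this
  have key := variance_gaussLaw_lt (μ := (volume : Measure (Vec d)))
    (ν := (volume : Measure (Vec p)))
    (precisionForm_continuous lstar (lam₀, zstar lam₀)) h.a3.precisionForm_coercive
    h.precisionForm_graph_add hproj
  rw [← Measure.volume_eq_prod] at key
  exact key

theorem tendsto_center_graph (h : RegularData M E K lam₀ zstar lstar y)
    (hc : M.IsCenter lam₀ y lamn) :
    Tendsto (fun n => (lamn n, M.zhat y n (lamn n))) atTop (𝓝 (lam₀, zstar lam₀)) :=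
  (h.tendsto_graph h.mem).comp (tendsto_id.prodMk hc.1)

theorem laplaceFamily_full (h : RegularData M E K lam₀ zstar lstar y)
    (hc : M.IsCenter lam₀ y lamn) (ρ : JointPrior M)
    (hρ : ContinuousAt ρ.density (lam₀, zstar lam₀)) (hρ0 : 0 < ρ.density (lam₀, zstar lam₀)) :
    LaplaceFamily volume (M.Θ ×ˢ M.Z) ρ.density (fun n x => M.L n (fun i => y i) x.1 x.2)
      (M.ellPair y) (fun n => (lamn n, M.zhat y n (lamn n))) (lam₀, zstar lam₀)
      (lstar (lam₀, zstar lam₀)) (precisionForm lstar (lam₀, zstar lam₀)) := by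
  obtain ⟨r, hr, hE, hZ, hz, hl⟩ := h.exists_uniformlyC3 h.mem
  have hx := h.tendsto_center_graph hc
  have hcrit := h.eventually_fderiv_eq_zero hc
  refine
    { measurableSet := M.measurableSet_Θ.prod M.measurableSet_Z
      mem_nhds := prod_mem_nhds
        (mem_of_superset (Metric.ball_mem_nhds _ hr) (hE.trans h.subset))
        (mem_of_superset (Metric.ball_mem_nhds _ hr) hZ)
      prior_nonneg := ρ.density_nonneg
      prior_measurable := ρ.density_measurable
      prior_continuousAt := hρ
      prior_pos := hρ0
      likelihood_aemeasurable := Eventually.of_forall fun n => (M.L_measurable n _).aemeasurable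
      likelihood_eq := ?_
      tendsto_center := hx
      tendsto_value := hl.tendsto_prod.comp (tendsto_id.prodMk hx)
      sub_le := hl.exists_sub_le h.a3.precisionForm_pos hx hcrit
      tendsto_mul_sub := fun u => ?_
      form_continuous := precisionForm_continuous _ _
      form_coercive := h.a3.precisionForm_coercive }
  · filter_upwards [eventually_gt_atTop 0] with n hn x hx
    exact likelihood_eq_exp hn hx.1 hx.2
  · rw [precisionForm, neg_neg]
    exact hl.tendsto_mul_sub hx hcrit tendsto_const_nhds

/-- The profile likelihood is the restriction of the likelihood to the graph of `ẑₙ`, hence inherits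
the quadratic upper bound and the expansion at the centers, with the precision form restricted to
the graph of `ẑ_*'(lam₀)`. -/
theorem laplaceFamily_bridged (h : RegularData M E K lam₀ zstar lstar y)
    (hc : M.IsCenter lam₀ y lamn) (hπ : ContinuousAt M.prior lam₀) (hπ0 : 0 < M.prior lam₀) :
    LaplaceFamily volume M.Θ M.prior (fun n lam => M.L n (fun i => y i) lam (M.zhat y n lam))
      (M.ellHat y) lamn lam₀ (lstar (lam₀, zstar lam₀))
      (fun u => precisionForm lstar (lam₀, zstar lam₀) (u, fderiv ℝ zstar lam₀ u)) := by
  obtain ⟨r, hr, hE, hZ, hz, hl⟩ := h.exists_uniformlyC3 h.mem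
  have hx := h.tendsto_center_graph hc
  have hcrit := h.eventually_fderiv_eq_zero hc
  refine
    { measurableSet := M.measurableSet_Θ
      mem_nhds := mem_of_superset (Metric.ball_mem_nhds _ hr) (hE.trans h.subset)
      prior_nonneg := M.prior_nonneg
      prior_measurable := M.prior_measurable
      prior_continuousAt := hπ
      prior_pos := hπ0
      likelihood_aemeasurable := ?_
      likelihood_eq := ?_
      tendsto_center := hc.1
      tendsto_value := (h.tendsto_ellHat h.mem).comp (tendsto_id.prodMk hc.1)
      sub_le := ?_
      tendsto_mul_sub := fun u => ?_
      form_continuous := (precisionForm_continuous _ _).comp (by fun_prop)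
      form_coercive := ?_ }
  · filter_upwards [eventually_gt_atTop 0] with n hn
    exact (M.L_measurable n _).comp_aemeasurable (aemeasurable_id.prodMk (h.wellPosed n hn).2)
  · filter_upwards [eventually_gt_atTop 0] with n hn lam hlam
    exact likelihood_eq_exp hn hlam (h.zhat_mem hn hlam)
  · obtain ⟨c, hc0, δ, hδ, hle⟩ := hl.exists_sub_le h.a3.precisionForm_pos hx hcrit
    obtain ⟨P, hP, R, hR, hPR⟩ := eventually_prod_iff.1
      ((h.tendsto_graph h.mem).eventually (Metric.ball_mem_nhds _ hδ))
    obtain ⟨δ', hδ', hRδ⟩ := Metric.eventually_nhds_iff_ball.1 hR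
    refine ⟨c, hc0, δ', hδ', ?_⟩
    filter_upwards [hle, hP] with n h1 h2 lam hlam
    refine (h1 _ (hPR h2 (hRδ lam hlam))).trans ?_
    gcongr
    exact norm_fst_le ((lam, M.zhat y n lam) - (lamn n, M.zhat y n (lamn n)))
  · have hw : Tendsto (fun n : ℕ => (u, √(n : ℝ) •
        (M.zhat y n (lamn n + (√(n : ℝ))⁻¹ • u) - M.zhat y n (lamn n)))) atTop
        (𝓝 (u, fderiv ℝ zstar lam₀ u)) :=
      tendsto_const_nhds.prodMk_nhds (hz.tendsto_sqrt_smul_sub hc.1 u)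
    rw [precisionForm, neg_neg]
    refine (hl.tendsto_mul_sub hx hcrit hw).congr' ?_
    filter_upwards [eventually_gt_atTop 0] with n hn
    have hs : 0 < √(n : ℝ) := Real.sqrt_pos.2 (Nat.cast_pos.2 hn)
    rw [Prod.smul_mk, inv_smul_smul₀ hs.ne', Prod.mk_add_mk, add_sub_cancel]
    rfl
  · obtain ⟨c, hc0, hle⟩ := h.a3.precisionForm_coercive
    refine ⟨c, hc0, fun u => le_trans ?_ (hle _)⟩
    gcongr
    exact norm_fst_le (u, fderiv ℝ zstar lam₀ u)

theorem hasAsymptoticVariance_bridged (h : RegularData M E K lam₀ zstar lstar y)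
    (hc : M.IsCenter lam₀ y lamn) (hπ : ContinuousAt M.prior lam₀) (hπ0 : 0 < M.prior lam₀) :
    HasAsymptoticVariance (M.bridgedLatentLaw y lamn)
      (fun j => variance (fun u => fderiv ℝ zstar lam₀ u j) (gaussLaw volume fun u =>
        precisionForm lstar (lam₀, zstar lam₀) (u, fderiv ℝ zstar lam₀ u))) := by
  obtain ⟨r, hr, hE, hZ, hz, hl⟩ := h.exists_uniformlyC3 h.mem
  have hL := h.laplaceFamily_bridged hc hπ hπ0
  refine hL.hasAsymptoticVariance (fun δ hδ => ?_)
    (T := fun n lam => √(n : ℝ) • (M.zhat y n lam - M.zhat y n (lamn n))) ?_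
    (fun u => hz.tendsto_sqrt_smul_sub hc.1 u)
  · obtain ⟨c, hc0, hle⟩ := h.exists_ellHat_le hδ
    refine hL.tendsto_mul_of_le Metric.isOpen_ball.measurableSet.compl ?_ hc0 hle
    refine (lintegral_mono_set Set.inter_subset_left).trans_lt ?_
    rw [M.prior_integral]
    exact ENNReal.one_lt_top
  · filter_upwards [eventually_gt_atTop 0] with n hn
    exact ((h.wellPosed n hn).2.sub_const (M.zhat y n (lamn n))).const_smul √(n : ℝ)

/-- The full posterior has the asymptotic variances of the Gaussian law with precision `-l_*''`, as
soon as its mass away from `(lam₀, ζ₀)` is negligible. -/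
theorem hasAsymptoticVariance_full (h : RegularData M E K lam₀ zstar lstar y)
    (hc : M.IsCenter lam₀ y lamn) (ρ : JointPrior M)
    (hρ : ContinuousAt ρ.density (lam₀, zstar lam₀)) (hρ0 : 0 < ρ.density (lam₀, zstar lam₀))
    (hfar : ∀ δ > 0, Tendsto (fun n =>
      ENNReal.ofReal (laplaceScale (M.ellPair y) (fun n => (lamn n, M.zhat y n (lamn n))) n) *
      posteriorMeasure volume (M.Θ ×ˢ M.Z) ρ.density (fun n x => M.L n (fun i => y i) x.1 x.2) n
        (Metric.ball (lam₀, zstar lam₀) δ)ᶜ) atTop (𝓝 0)) :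
    HasAsymptoticVariance (M.fullLatentLaw ρ y lamn)
      (fun j => variance (fun x : Vec d × Vec p => x.2 j)
        (gaussLaw volume (precisionForm lstar (lam₀, zstar lam₀)))) := by
  refine (h.laplaceFamily_full hc ρ hρ hρ0).hasAsymptoticVariance hfar
    (T := fun n x => √(n : ℝ) • (x.2 - M.zhat y n (lamn n)))
    (T₀ := ContinuousLinearMap.snd ℝ (Vec d) (Vec p))
    (Eventually.of_forall fun n => by fun_prop) (fun u => ?_)
  refine tendsto_const_nhds.congr' ?_
  filter_upwards [eventually_gt_atTop 0] with n hn
  have hs : 0 < √(n : ℝ) := Real.sqrt_pos.2 (Nat.cast_pos.2 hn)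
  simp [hs.ne']

/-- The separation in `lam` holds for all `ζ ∈ Z`, since `lₙ(lam, ζ) ≤ l̂ₙ(lam)`. -/
theorem ellPair_le_of_mem (h : RegularData M E K lam₀ zstar lstar y) {δ : ℝ} (hδ : 0 < δ) :
    ∃ c < lstar (lam₀, zstar lam₀), ∀ᶠ n in atTop, ∀ x ∈ M.Θ ×ˢ M.Z,
      δ ≤ ‖x.1 - lam₀‖ → M.ellPair y n x ≤ c := by
  obtain ⟨c, hc, hle⟩ := h.exists_ellHat_le hδ
  refine ⟨c, hc, ?_⟩
  filter_upwards [hle, eventually_gt_atTop 0] with n hn hn0 x hx hxδ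
  refine (h.ell_le_ellHat hn0 hx.1 hx.2).trans (hn x.1 ⟨hx.1, ?_⟩)
  rwa [Metric.mem_ball, dist_eq_norm, not_lt]

/-- With a proper prior, separation in `ζ` makes the mass away from `(lam₀, ζ₀)` negligible. -/
theorem tendsto_far_of_separated (h : RegularData M E K lam₀ zstar lstar y)
    (hc : M.IsCenter lam₀ y lamn) (ρ : JointPrior M)
    (hρ : ContinuousAt ρ.density (lam₀, zstar lam₀)) (hρ0 : 0 < ρ.density (lam₀, zstar lam₀))
    (hproper : ρ.IsProper)
    (hsep : M.SeparatedInLatent (zstar lam₀) (lstar (lam₀, zstar lam₀)) y) (δ : ℝ) (hδ : 0 < δ) :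
    Tendsto (fun n =>
      ENNReal.ofReal (laplaceScale (M.ellPair y) (fun n => (lamn n, M.zhat y n (lamn n))) n) *
      posteriorMeasure volume (M.Θ ×ˢ M.Z) ρ.density (fun n x => M.L n (fun i => y i) x.1 x.2) n
        (Metric.ball (lam₀, zstar lam₀) δ)ᶜ) atTop (𝓝 0) := by
  obtain ⟨c, hc0, hle⟩ := h.ellPair_le_of_mem hδ
  obtain ⟨c', hc0', hle'⟩ := hsep δ hδ
  refine (h.laplaceFamily_full hc ρ hρ hρ0).tendsto_mul_of_le
    Metric.isOpen_ball.measurableSet.compl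
    ((lintegral_mono_set Set.inter_subset_left).trans_lt hproper) (max_lt hc0 hc0') ?_
  filter_upwards [hle, hle'] with n h1 h2 x hx
  have hxδ : δ ≤ ‖x - (lam₀, zstar lam₀)‖ := by
    have := hx.2
    rwa [Set.mem_compl_iff, Metric.mem_ball, dist_eq_norm, not_lt] at this
  rw [Prod.norm_def, le_max_iff] at hxδ
  rcases hxδ with hxδ | hxδ
  · exact (h1 x hx.1 hxδ).trans (le_max_left _ _)
  · exact (h2 x.1 hx.1.1 x.2 hx.1.2 hxδ).trans (le_max_right _ _)

/-- If the rescaled latent variable converges in law under the full posterior, then the posterior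
probability of `‖ζ - ζ₀‖ ≥ δ` tends to zero by tightness; where `‖ζ - ζ₀‖ < δ` the prior mass is
finite, and `lam` is separated from `lam₀` by `ellPair_le_of_mem`. -/
theorem tendsto_far_of_hasAsymptoticVariance (h : RegularData M E K lam₀ zstar lstar y)
    (hc : M.IsCenter lam₀ y lamn) (ρ : JointPrior M)
    (hρ : ContinuousAt ρ.density (lam₀, zstar lam₀)) (hρ0 : 0 < ρ.density (lam₀, zstar lam₀))
    {w : Fin p → ℝ} (hw : HasAsymptoticVariance (M.fullLatentLaw ρ y lamn) w) (δ : ℝ) (hδ : 0 < δ) :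
    Tendsto (fun n =>
      ENNReal.ofReal (laplaceScale (M.ellPair y) (fun n => (lamn n, M.zhat y n (lamn n))) n) *
      posteriorMeasure volume (M.Θ ×ˢ M.Z) ρ.density (fun n x => M.L n (fun i => y i) x.1 x.2) n
        (Metric.ball (lam₀, zstar lam₀) δ)ᶜ) atTop (𝓝 0) := by
  obtain ⟨ν, hν, hlim, -⟩ := hw
  have hL := h.laplaceFamily_full hc ρ hρ hρ0
  set m := posteriorMeasure volume (M.Θ ×ˢ M.Z) ρ.density
    (fun n x => M.L n (fun i => y i) x.1 x.2)
  have hT : ∀ n : ℕ, Measurable fun x : Vec d × Vec p => √(n : ℝ) • (x.2 - M.zhat y n (lamn n)) :=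
    fun n => by fun_prop
  have hlaw : ∀ n, M.fullLatentLaw ρ y lamn n =
    (normalize (m n)).map fun x => √(n : ℝ) • (x.2 - M.zhat y n (lamn n)) := fun n => rfl
  -- `normalize` yields the zero measure when the total mass is zero or infinite; this is excluded
  -- by convergence of the integrals of the constant function one
  have hfin : ∀ᶠ n in atTop, m n Set.univ ≠ 0 ∧ m n Set.univ ≠ ⊤ := by
    have h1 := hlim (BoundedContinuousFunction.const _ 1)
    simp only [BoundedContinuousFunction.const_apply, integral_const, smul_eq_mul, mul_one,
      probReal_univ] at h1
    filter_upwards [h1.eventually_const_lt zero_lt_one] with n hn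
    rw [hlaw, Measure.real, Measure.map_apply (hT n) MeasurableSet.univ, Set.preimage_univ,
      normalize, Measure.smul_apply, smul_eq_mul] at hn
    constructor
    · intro h0
      simp [h0] at hn
    · intro htop
      simp [htop] at hn
  have hprob : ∀ᶠ n in atTop, IsProbabilityMeasure (M.fullLatentLaw ρ y lamn n) := by
    filter_upwards [hfin] with n hn
    refine ⟨?_⟩
    rw [hlaw, Measure.map_apply (hT n) MeasurableSet.univ, Set.preimage_univ, normalize,
      Measure.smul_apply, smul_eq_mul, ENNReal.inv_mul_cancel hn.1 hn.2]
  refine hL.tendsto_far_of_tendsto_normalize hfin (fun ε hε => ?_) δ hδ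
  refine ⟨{x | ε ≤ ‖x.2 - zstar lam₀‖}, {x | ε ≤ ‖x.1 - lam₀‖ ∧ ‖x.2 - zstar lam₀‖ < ε},
    fun x hx => ?_, ?_, ?_⟩
  · rw [Set.mem_compl_iff, Metric.mem_ball, dist_eq_norm, not_lt, Prod.norm_def, le_max_iff] at hx
    by_cases hx2 : ε ≤ ‖x.2 - zstar lam₀‖
    · exact Or.inl hx2
    · exact Or.inr ⟨hx.resolve_right hx2, not_le.1 hx2⟩
  · have ht : Tendsto (fun n : ℕ => √(n : ℝ) * (ε / 2)) atTop atTop :=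
      (Real.tendsto_sqrt_atTop.comp tendsto_natCast_atTop_atTop).atTop_mul_const (half_pos hε)
    have hz : Tendsto (fun n => M.zhat y n (lamn n)) atTop (𝓝 (zstar lam₀)) :=
      (continuous_snd.tendsto _).comp (h.tendsto_center_graph hc)
    refine tendsto_of_tendsto_of_tendsto_of_le_of_le' tendsto_const_nhds
      (tendsto_measure_norm_ge hprob hlim ht) (Eventually.of_forall fun _ => zero_le) ?_
    filter_upwards [hz.eventually (Metric.ball_mem_nhds _ (half_pos hε))] with n hn
    rw [hlaw, Measure.map_apply (hT n) (measurableSet_le (by fun_prop) (by fun_prop))]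
    refine measure_mono fun x hx => ?_
    have h1 : ε ≤ ‖x.2 - zstar lam₀‖ := hx
    have h2 : ‖M.zhat y n (lamn n) - zstar lam₀‖ < ε / 2 := mem_ball_iff_norm.1 hn
    have h3 := norm_sub_le_norm_sub_add_norm_sub x.2 (M.zhat y n (lamn n)) (zstar lam₀)
    change √(n : ℝ) * (ε / 2) ≤ ‖√(n : ℝ) • (x.2 - M.zhat y n (lamn n))‖
    rw [norm_smul, Real.norm_of_nonneg (Real.sqrt_nonneg _)]
    gcongr
    linarith
  · obtain ⟨c, hc0, hle⟩ := h.ellPair_le_of_mem hε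
    refine hL.tendsto_mul_of_le ?_ ?_ hc0 ?_
    · have h1 : MeasurableSet {x : Vec d × Vec p | ε ≤ ‖x.1 - lam₀‖} :=
        measurableSet_le (by fun_prop) (by fun_prop)
      have h2 : MeasurableSet {x : Vec d × Vec p | ‖x.2 - zstar lam₀‖ < ε} :=
        measurableSet_lt (by fun_prop) (by fun_prop)
      exact h1.inter h2
    · refine (lintegral_mono_set ?_).trans_lt (ρ.finite_of_bounded (‖zstar lam₀‖ + ε))
      rintro x ⟨hx, -, hxε⟩
      refine ⟨hx.1, hx.2, ?_⟩
      rw [mem_ball_zero_iff]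
      linarith [norm_le_norm_add_norm_sub' x.2 (zstar lam₀)]
    · filter_upwards [hle] with n hn x hx using hn x hx.1 hx.2.1

end RegularData

end Bridged

theorem mainTheorem3 {Ω 𝒴 : Type*} [MeasurableSpace Ω] (P : Measure Ω) [IsProbabilityMeasure P]
    (d p : ℕ) (M : Bridged.Model 𝒴 d p) (ρ : Bridged.JointPrior M) (y : ℕ → Ω → 𝒴)
    (E : Set (Bridged.Vec d)) (lam₀ : Bridged.Vec d)
    (zstar : Bridged.Vec d → Bridged.Vec p) (lstar : Bridged.Vec d × Bridged.Vec p → ℝ)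
    (hE_open : IsOpen E) (hE_bdd : Bornology.IsBounded E) (hE_sub : E ⊆ M.Θ) (hlam₀ : lam₀ ∈ E)
    (hprior_cont : ContinuousAt M.prior lam₀) (hprior_pos : 0 < M.prior lam₀)
    (hρ_cont : ContinuousAt ρ.density (lam₀, zstar lam₀))
    (hρ_pos : 0 < ρ.density (lam₀, zstar lam₀))
    (hprofile : M.IsProfile)
    (hwell : ∀ᵐ ω ∂P, M.WellPosed (fun i => y i ω))
    (hA1 : ∀ᵐ ω ∂P, M.A1 E (fun i => y i ω))
    (hA2 : ∀ᵐ ω ∂P, M.A2 zstar lstar (fun i => y i ω))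
    (hA3 : Bridged.A3 lam₀ zstar lstar)
    (hA4 : ∃ K : Set (Bridged.Vec d), IsCompact K ∧ K ⊆ E ∧ lam₀ ∈ interior K ∧
      Bridged.A4Inside K E lam₀ zstar lstar ∧
      ∀ᵐ ω ∂P, M.A4Outside K (lstar (lam₀, zstar lam₀)) (fun i => y i ω)) :
    ∃ v w : Fin p → ℝ, (∀ j, v j < w j) ∧
      ∀ᵐ ω ∂P,
        (∃ lamn : ℕ → Bridged.Vec d, M.IsCenter lam₀ (fun i => y i ω) lamn) ∧
        ∀ lamn : ℕ → Bridged.Vec d, M.IsCenter lam₀ (fun i => y i ω) lamn →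
          Bridged.HasAsymptoticVariance (M.bridgedLatentLaw (fun i => y i ω) lamn) v ∧
          (∀ w' : Fin p → ℝ,
            Bridged.HasAsymptoticVariance (M.fullLatentLaw ρ (fun i => y i ω) lamn) w' → w' = w) ∧
          (ρ.IsProper →
            M.SeparatedInLatent (zstar lam₀) (lstar (lam₀, zstar lam₀)) (fun i => y i ω) →
            Bridged.HasAsymptoticVariance (M.fullLatentLaw ρ (fun i => y i ω) lamn) w) := by
  obtain ⟨K, hK, hKE, -, hin, hout⟩ := hA4
  have hreg : ∀ᵐ ω ∂P, Bridged.RegularData M E K lam₀ zstar lstar (fun i => y i ω) := by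
    filter_upwards [hwell, hA1, hA2, hout] with ω h1 h2 h3 h4
    exact ⟨hE_open, hE_sub, hlam₀, hprofile, h1, h2, h3, hA3, hK, hKE, hin, h4⟩
  -- the forms are nonrandom, so their splitting may be read off from a single data sequence
  obtain ⟨ω₀, hω₀⟩ := hreg.exists
  refine ⟨fun j => variance (fun u => fderiv ℝ zstar lam₀ u j) (Bridged.gaussLaw volume fun u =>
      Bridged.precisionForm lstar (lam₀, zstar lam₀) (u, fderiv ℝ zstar lam₀ u)),
    fun j => variance (fun x : Bridged.Vec d × Bridged.Vec p => x.2 j)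
      (Bridged.gaussLaw volume (Bridged.precisionForm lstar (lam₀, zstar lam₀))), fun j => ?_, ?_⟩
  · exact hω₀.variance_lt j
  · filter_upwards [hreg] with ω hω
    refine ⟨hω.exists_isCenter, fun lamn hc => ⟨hω.hasAsymptoticVariance_bridged hc hprior_cont
      hprior_pos, fun w' hw' => ?_, fun hproper hsep => ?_⟩⟩
    · exact hw'.unique (hω.hasAsymptoticVariance_full hc ρ hρ_cont hρ_pos
        (hω.tendsto_far_of_hasAsymptoticVariance hc ρ hρ_cont hρ_pos hw'))
    · exact hω.hasAsymptoticVariance_full hc ρ hρ_cont hρ_pos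
        (hω.tendsto_far_of_separated hc ρ hρ_cont hρ_pos hproper hsep)
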